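/- Let $X=(X_1,\dots,X_m)$ be an $m$-tuple of linearly independent smooth vector fields on $\mathbb R^n$, $X_i=\sum_{j}a_{ij}\partial_{x_j}$. For an open set $\Omega\subset\mathbb R^n$ and $\varphi\in C^1_c(\Omega;\mathbb R^m)$ put $\operatorname{div}_X\varphi:=\sum_{i=1}^m\sum_{j=1}^n\partial_{x_j}(a_{ij}\varphi_i)$. A function $u\in L^1(\Omega)$ belongs to $BV_H(\Omega)$ if there is an $\mathbb R^m$-valued Radon measure $D_Hu=(D_{X_1}u,\dots,D_{X_m}u)$ on $\Omega$ with finite total variation such that $$\int_\Omega\varphi\cdot d D_Hu=-\int_\Omega u\,\operatorname{div}_X\varphi\,d\mathscr L^n\qquad\text{for all }\varphi\in C^1_c(\Omega;\mathbb R^m).$$ A set $E\subset\Omega$ has finite $H$-perimeter in $\Omega$ if $\chi_E\in L^1_{loc}(\Omega)$ and there is a measure $D_H\chi_E$ with the same properties for $\chi_E$ in place of $u$. On $\mathbb R^{n+1}=\mathbb R^n\times\mathbb R$ consider the family $\widetilde X=(\widetilde X_1,\dots,\widetilde X_{m+1})$ with $\widetilde X_i(x,t)=(X_i(x),0)$ for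 $i\le m$ and $\widetilde X_{m+1}=\partial_t$; the corresponding notions on open subsets of $\mathbb R^{n+1}$ are defined in the same way, with $D_{\widetilde H}=(D_{\widetilde X_1},\dots,D_{\widetilde X_m},\partial_t)$ and $D'_{\widetilde H}=(D_{\widetilde X_1},\dots,D_{\widetilde X_m})$. Let $\pi(x,t)=x$, and let $|\mu|$ denote the total variation of a vector measure $\mu$ with respect to the Euclidean norm. Theorem. Let $\Omega\subset\mathbb R^n$ be open and bounded, let $u\in L^1(\Omega)$, and let $E_u=\{(x,t)\in\Omega\times\mathbb R: t<u(x)\}$. Then $u\in BV_H(\Omega)$ if and only if $E_u$ has finite $H$-perimeter in $\Omega\times\mathbb R$ with respect to $\widetilde X$. Moreover, in this case the following identities of measures on $\Omega$ hold: (i) $\pi_\# D_{\widetilde X_i}\chi_{E_u}=D_{X_i}u$ for $i=1,\dots,m$; (ii) $\pi_\#\,\partial_t\chi_{E_u}=-\mathscr L^n$; (iii) $\pi_\#|D_{\widetilde X_i}\chi_{E_u}|=|D_{X_i}u|$ for $i=1,\dots,m$; (iv) $\pi_\#|\partial_t\chi_{E_u}|=\mathscr L^n$; (v) $\pi_\#|D'_{\widetilde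 H}\chi_{E_u}|=|D_Hu|$; (vi) $\pi_\#|D_{\widetilde H}\chi_{E_u}|=|(D_Hu,-\mathscr L^n)|$. -/

import Mathlib

open MeasureTheory Set
open scoped ContDiff

noncomputable section

namespace HVar

section General

variable {E : Type*} [NormedAddCommGroup E] [NormedSpace ℝ E] {ι : Type*}

/-- The divergence `∑ⱼ ∂ⱼ Vⱼ` of a vector field `V`, i.e. the trace of its derivative. -/
def divergence (V : E → E) (x : E) : ℝ :=
  LinearMap.trace ℝ E (fderiv ℝ V x).toLinearMap

/-- `div_X φ = ∑ᵢ div (φᵢ Xᵢ) = ∑ᵢ ∑ⱼ ∂ⱼ (aᵢⱼ φᵢ)`, where `Xᵢ = ∑ⱼ aᵢⱼ ∂ⱼ`. -/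
def divX [Fintype ι] (X : ι → E → E) (φ : E → EuclideanSpace ℝ ι) (x : E) : ℝ :=
  ∑ i, divergence (fun y => φ y i • X i y) x

/-- The `ℝ^ι`-valued measure `(μᵢ)ᵢ` with components `μᵢ`; `ℝ^ι` carries the Euclidean norm. -/
def ofComponents {α : Type*} [MeasurableSpace α] (μ : ι → SignedMeasure α) :
    VectorMeasure α (EuclideanSpace ℝ ι) where
  measureOf' A := WithLp.toLp 2 fun i => μ i A
  empty' := by ext i; simp
  not_measurable' A hA := by ext i; simp [hA]
  m_iUnion' f hf hd := by
    have h : HasSum (fun k i => μ i (f k)) (fun i => μ i (⋃ k, f k)) :=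
      Pi.hasSum.2 fun i => (μ i).m_iUnion hf hd
    exact h.map (WithLp.linearEquiv 2 ℝ (ι → ℝ)).symm (PiLp.continuous_toLp 2 _)

/-- The total variation `|(μᵢ)ᵢ|` of the vector measure `(μᵢ)ᵢ`, a positive measure:
the supremum of `∑ ‖μ (Bₗ)‖` over partitions, with the Euclidean norm. -/
def totalVar [Fintype ι] {α : Type*} [MeasurableSpace α] (μ : ι → SignedMeasure α) :
    Measure α :=
  (ofComponents μ).variation

variable [MeasureSpace E] [Fintype ι]

/-- The finite vector measure `D = (Dᵢ)ᵢ` on the open set `Ω` is the distributional horizontal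
derivative `(D_{X₁} u, …, D_{Xₘ} u)` of `u` in `Ω`. A measure on `Ω` is regarded as a measure on
the whole space which vanishes off `Ω`. -/
structure IsHDeriv (X : ι → E → E) (Ω : Set E) (u : E → ℝ) (D : ι → SignedMeasure E) :
    Prop where
  concentrated : ∀ i A, MeasurableSet A → Disjoint A Ω → D i A = 0
  finite_variation : totalVar D univ < ⊤
  integral_eq : ∀ φ : E → EuclideanSpace ℝ ι,
    ContDiff ℝ 1 φ → HasCompactSupport φ → tsupport φ ⊆ Ω →
      ∑ i, ∫ᵛ x, φ x i ∂•(D i) = -∫ x in Ω, u x * divX X φ x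

/-- `u ∈ BV_H(Ω)`: `u` is integrable on `Ω` and has a horizontal derivative that is a vector
measure with finite total variation on `Ω`. -/
def MemBVH (X : ι → E → E) (Ω : Set E) (u : E → ℝ) : Prop :=
  IntegrableOn u Ω ∧ ∃ D : ι → SignedMeasure E, IsHDeriv X Ω u D

/-- `S ⊆ Ω` has finite `H`-perimeter in `Ω`: its characteristic function, a locally integrable
function, has a horizontal derivative that is a vector measure with finite total variation
on `Ω`. (The Lebesgue measure of `S` may be infinite.) -/
def HasFiniteHPerimeter (X : ι → E → E) (Ω S : Set E) : Prop :=
  S ⊆ Ω ∧ LocallyIntegrableOn (S.indicator fun _ => (1 : ℝ)) Ω ∧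
    ∃ D : ι → SignedMeasure E, IsHDeriv X Ω (S.indicator fun _ => (1 : ℝ)) D

end General

variable {n m : ℕ}

/-- The family `(X₁, …, Xₘ, ∂ₜ)` on `ℝⁿ × ℝ`. -/
def extend (X : Fin m → EuclideanSpace ℝ (Fin n) → EuclideanSpace ℝ (Fin n)) :
    Fin (m + 1) → EuclideanSpace ℝ (Fin n) × ℝ → EuclideanSpace ℝ (Fin n) × ℝ :=
  Fin.snoc (α := fun _ => EuclideanSpace ℝ (Fin n) × ℝ → EuclideanSpace ℝ (Fin n) × ℝ)
    (fun i p => (X i p.1, 0)) (fun _ => (0, 1))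

/-- The subgraph `{(x, t) ∈ Ω × ℝ : t < u x}`. -/
def subgraph (Ω : Set (EuclideanSpace ℝ (Fin n))) (u : EuclideanSpace ℝ (Fin n) → ℝ) :
    Set (EuclideanSpace ℝ (Fin n) × ℝ) :=
  {p | p.1 ∈ Ω ∧ p.2 < u p.1}

/-- Lebesgue measure on the bounded set `Ω`, as a signed measure. -/
def lebesgueSigned (Ω : Set (EuclideanSpace ℝ (Fin n))) (hΩ : Bornology.IsBounded Ω) :
    SignedMeasure (EuclideanSpace ℝ (Fin n)) :=
  haveI : IsFiniteMeasure (volume.restrict Ω) :=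
    ⟨by simpa using hΩ.measure_lt_top⟩
  (volume.restrict Ω).toSignedMeasure

/-- The vector measure `(D, -𝓛ⁿ)` on `Ω`. -/
def appendNegLebesgue (Ω : Set (EuclideanSpace ℝ (Fin n))) (hΩ : Bornology.IsBounded Ω)
    (D : Fin m → SignedMeasure (EuclideanSpace ℝ (Fin n))) :
    Fin (m + 1) → SignedMeasure (EuclideanSpace ℝ (Fin n)) :=
  Fin.snoc (α := fun _ => SignedMeasure (EuclideanSpace ℝ (Fin n))) D (-lebesgueSigned Ω hΩ)

end HVar

end

/-!
Mollify `u`. For a `C¹` function, shearing its undergraph onto a half space turns the derivative of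
the undergraph into an integral over the graph, with density `(X̃ w, -1)`. Friedrichs' commutator
estimate replaces the derivative `X w` of the mollification by the mollification of the measure
`D_X u`, so in the limit `D χ_{E_u}` is a limit of measures on graphs whose masses are at most the
mass of `(D_H u, -𝓛ⁿ)`. Hence it is a measure, and `|D χ_{E_u}|(Ω × ℝ) ≤ |(D_H u, -𝓛ⁿ)|(Ω)`.

Conversely, testing `D χ_{E_u}` against `ψ(x) η(t)` and letting the cutoff `η` increase to `1` shows
`π_# D χ_{E_u} = (D_H u, -𝓛ⁿ)`, so that `|(D_H u, -𝓛ⁿ)| ≤ π_# |D χ_{E_u}|`. Two finite measures,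
one below the other, with the total masses ordered the opposite way, coincide. The same argument
applies to every subfamily of components.
-/

noncomputable section

open Filter Function Topology
open scoped ENNReal NNReal Convolution

namespace HVar

section SignedMeasures

variable {α : Type*} [MeasurableSpace α]

instance isFiniteMeasure_variation (μ : SignedMeasure α) : IsFiniteMeasure μ.variation := by
  rw [← SignedMeasure.totalVariation_eq_variation, SignedMeasure.totalVariation]
  infer_instance

lemma lsmul_flip_self :
    (ContinuousLinearMap.lsmul ℝ ℝ : ℝ →L[ℝ] ℝ →L[ℝ] ℝ).flip = ContinuousLinearMap.lsmul ℝ ℝ := by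
  ext
  simp

lemma integral_signed_toSignedMeasure (μ : Measure α) [IsFiniteMeasure μ] (f : α → ℝ) :
    ∫ᵛ x, f x ∂•μ.toSignedMeasure = ∫ x, f x ∂μ := by
  rw [← lsmul_flip_self, VectorMeasure.integral_toSignedMeasure]

lemma integral_signed_eq_sub (μ : SignedMeasure α) {f : α → ℝ} (hf : Integrable f μ.variation) :
    ∫ᵛ x, f x ∂•μ = ∫ x, f x ∂μ.toJordanDecomposition.posPart -
      ∫ x, f x ∂μ.toJordanDecomposition.negPart := by
  rw [← SignedMeasure.totalVariation_eq_variation, SignedMeasure.totalVariation,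
    integrable_add_measure] at hf
  conv_lhs => rw [← SignedMeasure.toSignedMeasure_toJordanDecomposition μ]
  rw [JordanDecomposition.toSignedMeasure,
    VectorMeasure.integral_sub_vectorMeasure (by simpa [VectorMeasure.Integrable] using hf.1)
      (by simpa [VectorMeasure.Integrable] using hf.2),
    integral_signed_toSignedMeasure, integral_signed_toSignedMeasure]

variable {ι : Type*}

@[simp]
lemma ofComponents_apply (μ : ι → SignedMeasure α) (A : Set α) (i : ι) :
    ofComponents μ A i = μ i A := rfl

variable [Fintype ι]

lemma variation_le_totalVar (μ : ι → SignedMeasure α) (i : ι) :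
    (μ i).variation ≤ totalVar μ := by
  refine VectorMeasure.variation_le_of_forall_enorm_le fun A _ => ?_
  refine le_trans ?_ (VectorMeasure.enorm_measure_le_variation (ofComponents μ) A)
  rw [enorm_le_iff_norm_le, ← ofComponents_apply μ A i]
  exact PiLp.norm_apply_le _ _

lemma totalVar_le_sum (μ : ι → SignedMeasure α) :
    totalVar μ ≤ ∑ i, (μ i).variation := by
  classical
  refine VectorMeasure.variation_le_of_forall_enorm_le fun A _ => ?_
  have hA : ofComponents μ A = ∑ i, EuclideanSpace.single i (μ i A) := by
    ext j
    simp
  rw [hA, Measure.finsetSum_apply]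
  refine (enorm_sum_le _ _).trans (Finset.sum_le_sum fun i _ => ?_)
  refine le_trans (le_of_eq ?_) (VectorMeasure.enorm_measure_le_variation (μ i) A)
  rw [← ofReal_norm, ← ofReal_norm, PiLp.norm_single]

instance isFiniteMeasure_totalVar (μ : ι → SignedMeasure α) : IsFiniteMeasure (totalVar μ) :=
  isFiniteMeasure_of_le _ (totalVar_le_sum μ)

instance isFiniteMeasure_variation_ofComponents (μ : ι → SignedMeasure α) :
    IsFiniteMeasure (ofComponents μ).variation :=
  isFiniteMeasure_totalVar μ

lemma totalVar_unique [Unique ι] (μ : ι → SignedMeasure α) :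
    totalVar μ = (μ default).variation := by
  refine le_antisymm ((totalVar_le_sum μ).trans ?_) (variation_le_totalVar μ default)
  simp

lemma totalVar_map_le {β : Type*} [MeasurableSpace β] {g : α → β} (hg : Measurable g)
    (μ : ι → SignedMeasure α) :
    totalVar (fun i => (μ i).map g) ≤ (totalVar μ).map g := by
  have h : ofComponents (fun i => (μ i).map g) = (ofComponents μ).map g := by
    ext A hA i
    simp [VectorMeasure.map_apply _ hg hA]
  rw [totalVar, h]
  exact VectorMeasure.variation_map_le

lemma transpose_ofComponents_toSpanSingleton [DecidableEq ι] (μ : ι → SignedMeasure α) (i : ι) :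
    (ofComponents μ).transpose ((innerSL ℝ).comp (ContinuousLinearMap.toSpanSingleton ℝ
      (EuclideanSpace.single i (1 : ℝ)))) = (μ i).transpose (ContinuousLinearMap.lsmul ℝ ℝ) := by
  ext A _
  simp only [transpose_eq_cbmApplyMeasure, cbmApplyMeasure_apply,
    ContinuousLinearMap.comp_apply, ContinuousLinearMap.toSpanSingleton_apply, one_smul]
  refine (innerSL_apply_apply ℝ _ _).trans ?_
  simp [EuclideanSpace.inner_single_left]

lemma integral_inner_single_ofComponents [DecidableEq ι] (μ : ι → SignedMeasure α) (i : ι)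
    {f : α → ℝ} (hf : Integrable f (totalVar μ)) :
    ∫ᵛ x, ContinuousLinearMap.toSpanSingleton ℝ (EuclideanSpace.single i (1 : ℝ)) (f x)
      ∂[innerSL ℝ; ofComponents μ] = ∫ᵛ x, f x ∂•(μ i) := by
  rw [VectorMeasure.integral_continuousLinearMap_comp hf,
    VectorMeasure.integral_eq_setToFun_transpose hf,
    VectorMeasure.integral_eq_setToFun_transpose (hf.mono_measure (variation_le_totalVar μ i))]
  simp only [transpose_ofComponents_toSpanSingleton]

lemma integral_inner_ofComponents (μ : ι → SignedMeasure α) {f : α → EuclideanSpace ℝ ι}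
    (hf : Integrable f (totalVar μ)) :
    ∫ᵛ x, f x ∂[innerSL ℝ; ofComponents μ] = ∑ i, ∫ᵛ x, f x i ∂•(μ i) := by
  classical
  have hfi : ∀ i, Integrable (fun x => f x i) (totalVar μ) := fun i =>
    (EuclideanSpace.proj (𝕜 := ℝ) i : EuclideanSpace ℝ ι →L[ℝ] ℝ).integrable_comp hf
  have hsum : f = fun x => ∑ i,
      ContinuousLinearMap.toSpanSingleton ℝ (EuclideanSpace.single i (1 : ℝ)) (f x i) := by
    ext x j
    simp [ContinuousLinearMap.toSpanSingleton_apply, Pi.single_apply]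
  calc ∫ᵛ x, f x ∂[innerSL ℝ; ofComponents μ]
      = ∫ᵛ x, ∑ i, ContinuousLinearMap.toSpanSingleton ℝ (EuclideanSpace.single i (1 : ℝ)) (f x i)
          ∂[innerSL ℝ; ofComponents μ] := by
        congr 1
    _ = ∑ i, ∫ᵛ x, ContinuousLinearMap.toSpanSingleton ℝ (EuclideanSpace.single i (1 : ℝ)) (f x i)
          ∂[innerSL ℝ; ofComponents μ] :=
        VectorMeasure.integral_finsetSum _ fun i _ => ContinuousLinearMap.integrable_comp _ (hfi i)
    _ = ∑ i, ∫ᵛ x, f x i ∂•(μ i) :=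
        Finset.sum_congr rfl fun i _ => integral_inner_single_ofComponents μ i (hfi i)

lemma norm_integral_innerSL_le {V : Type*} [NormedAddCommGroup V] [InnerProductSpace ℝ V]
    (μ : VectorMeasure α V) (f : α → V) :
    ‖∫ᵛ x, f x ∂[innerSL ℝ; μ]‖ ≤ ∫ x, ‖f x‖ ∂μ.variation := by
  refine VectorMeasure.norm_integral_le_integral_norm.trans ?_
  exact mul_le_of_le_one_left (integral_nonneg fun _ => norm_nonneg _) (norm_innerSL_le ℝ)

lemma abs_sum_integral_le (μ : ι → SignedMeasure α) {f : α → EuclideanSpace ℝ ι}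
    (hf : Integrable f (totalVar μ)) :
    |∑ i, ∫ᵛ x, f x i ∂•(μ i)| ≤ ∫ x, ‖f x‖ ∂totalVar μ := by
  rw [← integral_inner_ofComponents μ hf, ← Real.norm_eq_abs]
  exact norm_integral_innerSL_le _ f

end SignedMeasures

section Duality

variable {E : Type*} [NormedAddCommGroup E] [NormedSpace ℝ E] [FiniteDimensional ℝ E]

lemma exists_contDiff_eq_one_on_isCompact {K U : Set E} (hK : IsCompact K) (hU : IsOpen U)
    (hKU : K ⊆ U) :
    ∃ χ : E → ℝ, ContDiff ℝ ∞ χ ∧ HasCompactSupport χ ∧ tsupport χ ⊆ U ∧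
      (∀ x, χ x ∈ Icc (0 : ℝ) 1) ∧ EqOn χ 1 K := by
  obtain ⟨L, hL, hKL, hLU⟩ := exists_compact_between hK hU hKU
  obtain ⟨χ, hχ1, hχ0, hχ⟩ := exists_contMDiffMap_one_nhds_of_subset_interior
    (n := (⊤ : ℕ∞)) (modelWithCornersSelf ℝ E) hK.isClosed hKL
  have hsupp : tsupport χ ⊆ L :=
    closure_minimal (fun x hx => by_contra fun h => hx (hχ0 x h)) hL.isClosed
  exact ⟨χ, χ.contMDiff.contDiff, hL.of_isClosed_subset (isClosed_tsupport _) hsupp,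
    hsupp.trans hLU, hχ, fun x hx => hχ1.self_of_nhdsSet x hx⟩

variable [MeasurableSpace E] [BorelSpace E]

lemma integral_abs_sub_indicator_le {α : Type*} [MeasurableSpace α] {ν : Measure α}
    [IsFiniteMeasure ν] {χ : α → ℝ} (hχ : ∀ x, χ x ∈ Icc (0 : ℝ) 1) {K U p : Set α}
    (hK : MeasurableSet K) (hU : MeasurableSet U) (hp : MeasurableSet p) (hKp : K ⊆ p)
    (hχK : EqOn χ 1 K) (hχU : support χ ⊆ U) :
    ∫ x, |χ x - p.indicator 1 x| ∂ν ≤ ν.real (U \ K) + ν.real (p \ K) := by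
  have hmU := hU.diff hK
  have hmp := hp.diff hK
  have hint : ∀ {s : Set α}, MeasurableSet s → Integrable (s.indicator (1 : α → ℝ)) ν :=
    fun hs => (integrable_const 1).indicator hs
  rw [← integral_indicator_one hmU, ← integral_indicator_one hmp,
    ← integral_add (hint hmU) (hint hmp)]
  refine integral_mono_of_nonneg (Eventually.of_forall fun _ => abs_nonneg _)
    ((hint hmU).add (hint hmp)) (Eventually.of_forall fun x => ?_)
  obtain ⟨hx0, hx1⟩ := hχ x
  by_cases hxK : x ∈ K
  · simp [hχK hxK, hKp hxK, hxK]
  · by_cases hxU : x ∈ U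
    · by_cases hxp : x ∈ p <;> simp [hxK, hxU, hxp, abs_le] <;> constructor <;> linarith
    · have hx : χ x = 0 := notMem_support.1 fun h => hxU (hχU h)
      by_cases hxp : x ∈ p <;> simp [hxK, hxU, hxp, hx]

lemma exists_contDiff_approx_indicator {κ : Type*} [Finite κ] (ν : Measure E) [IsFiniteMeasure ν]
    {Ω : Set E} (hΩ : IsOpen Ω) (hν : ν Ωᶜ = 0) {p : κ → Set E}
    (hp : ∀ k, MeasurableSet (p k)) (hd : Pairwise (Disjoint on p)) {δ : ℝ} (hδ : 0 < δ) :
    ∃ χ : κ → E → ℝ, (∀ k, ContDiff ℝ ∞ (χ k)) ∧ (∀ k, HasCompactSupport (χ k)) ∧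
      (∀ k, tsupport (χ k) ⊆ Ω) ∧ (∀ k x, χ k x ∈ Icc (0 : ℝ) 1) ∧
      Pairwise (Disjoint on fun k => support (χ k)) ∧
      ∀ k, ∫ x, |χ k x - (p k).indicator 1 x| ∂ν ≤ δ := by
  have hδ' : ENNReal.ofReal (δ / 2) ≠ 0 := by simpa using hδ
  have hreal : ∀ {s : Set E}, ν s < ENNReal.ofReal (δ / 2) → ν.real s ≤ δ / 2 := fun h =>
    ENNReal.toReal_le_of_le_ofReal (half_pos hδ).le h.le
  have hcompact : ∀ k, ∃ K ⊆ p k ∩ Ω, IsCompact K ∧ ν ((p k ∩ Ω) \ K) < ENNReal.ofReal (δ / 2) :=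
    fun k => ((hp k).inter hΩ.measurableSet).exists_isCompact_sdiff_lt (measure_ne_top _ _) hδ'
  choose K hKp hK hνK using hcompact
  have hopen : ∀ k, ∃ U ⊇ K k, IsOpen U ∧ ν U < ⊤ ∧ ν (U \ K k) < ENNReal.ofReal (δ / 2) :=
    fun k => (hK k).measurableSet.exists_isOpen_sdiff_lt (measure_ne_top _ _) hδ'
  choose U hKU hU _ hνU using hopen
  have hKd : Pairwise (Disjoint on fun k => 𝓝ˢ (K k)) := fun k l hkl =>
    SeparatedNhds.disjoint_nhdsSet <|
      SeparatedNhds.of_isCompact_isCompact (hK k) (hK l) <| (hd hkl).mono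
        ((hKp k).trans inter_subset_left) ((hKp l).trans inter_subset_left)
  obtain ⟨N, hN, hNd⟩ := hKd.exists_mem_filter_of_disjoint
  choose χ hχ hχc hχt hχ01 hχK using fun k =>
    exists_contDiff_eq_one_on_isCompact (hK k)
      ((isOpen_interior (s := N k)).inter ((hU k).inter hΩ))
      (subset_inter (subset_interior_iff_mem_nhdsSet.2 (hN k))
        (subset_inter (hKU k) ((hKp k).trans inter_subset_right)))
  have hsupp : ∀ k, support (χ k) ⊆ interior (N k) ∩ (U k ∩ Ω) := fun k =>
    (subset_tsupport _).trans (hχt k)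
  refine ⟨χ, hχ, hχc, fun k => (hχt k).trans (inter_subset_right.trans inter_subset_right), hχ01,
    fun k l hkl => (hNd hkl).mono ((hsupp k).trans (inter_subset_left.trans interior_subset))
      ((hsupp l).trans (inter_subset_left.trans interior_subset)), fun k => ?_⟩
  have hνp : ν.real (p k \ K k) ≤ δ / 2 := by
    refine hreal ((measure_mono_ae ?_).trans_lt (hνK k))
    filter_upwards [mem_ae_iff.2 hν] with x hx hxp using ⟨⟨hxp.1, hx⟩, hxp.2⟩
  calc ∫ x, |χ k x - (p k).indicator 1 x| ∂ν
      ≤ ν.real (U k \ K k) + ν.real (p k \ K k) :=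
        integral_abs_sub_indicator_le (hχ01 k) (hK k).measurableSet (hU k).measurableSet (hp k)
          ((hKp k).trans inter_subset_left) (hχK k)
          ((hsupp k).trans (inter_subset_right.trans inter_subset_left))
    _ ≤ δ / 2 + δ / 2 := add_le_add (hreal (hνU k)) hνp
    _ = δ := add_halves δ

variable {V : Type*} [NormedAddCommGroup V] [InnerProductSpace ℝ V]

lemma norm_sum_smul_le_one {α κ : Type*} [Fintype κ] {χ : κ → α → ℝ}
    (hχ : ∀ k x, χ k x ∈ Icc (0 : ℝ) 1) (hd : Pairwise (Disjoint on fun k => support (χ k)))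
    {v : κ → V} (hv : ∀ k, ‖v k‖ ≤ 1) (x : α) : ‖∑ k, χ k x • v k‖ ≤ 1 := by
  by_cases hx : ∃ k, x ∈ support (χ k)
  · obtain ⟨k, hk⟩ := hx
    have hzero : ∀ l, l ≠ k → χ l x = 0 := fun l hl =>
      notMem_support.1 fun h => disjoint_left.1 (hd hl) h hk
    rw [Finset.sum_eq_single k (fun l _ hl => by rw [hzero l hl, zero_smul]) (by simp), norm_smul,
      Real.norm_of_nonneg (hχ k x).1]
    exact mul_le_one₀ (hχ k x).2 (norm_nonneg _) (hv k)
  · have hzero : ∀ k, χ k x = 0 := fun k => notMem_support.1 fun h => hx ⟨k, h⟩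
    simp [hzero]

lemma norm_integral_smul_sub_inner_le {α : Type*} [MeasurableSpace α] {μ : VectorMeasure α V}
    [IsFiniteMeasure μ.variation] {χ : α → ℝ} (hχ : Integrable χ μ.variation) {p : Set α}
    (hp : MeasurableSet p) (v : V) :
    |∫ᵛ x, χ x • v ∂[innerSL ℝ; μ] - inner ℝ v (μ p)| ≤
      ‖v‖ * ∫ x, |χ x - p.indicator 1 x| ∂μ.variation := by
  have hind : inner ℝ v (μ p) = ∫ᵛ x, p.indicator (fun _ => v) x ∂[innerSL ℝ; μ] := by
    rw [VectorMeasure.integral_indicator_const _ hp]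
    exact (innerSL_apply_apply ℝ _ _).symm
  have hsmul : ∀ x, p.indicator (fun _ => v) x = p.indicator (1 : α → ℝ) x • v := fun x => by
    by_cases hx : x ∈ p <;> simp [hx]
  rw [hind, ← VectorMeasure.integral_fun_sub (hχ.smul_const v)
    ((integrable_const v).indicator hp), ← Real.norm_eq_abs, ← integral_const_mul]
  refine (norm_integral_innerSL_le μ _).trans_eq
    (integral_congr_ae (Eventually.of_forall fun x => ?_))
  simp only [hsmul, ← sub_smul, norm_smul, Real.norm_eq_abs, mul_comm]

lemma exists_norm_le_one_inner_eq_norm (w : V) : ∃ v : V, ‖v‖ ≤ 1 ∧ inner ℝ v w = ‖w‖ := by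
  refine ⟨‖w‖⁻¹ • w, ?_, ?_⟩
  · rw [norm_smul, norm_inv, norm_norm]
    exact inv_mul_le_one
  · rw [real_inner_smul_left, real_inner_self_eq_norm_sq]
    rcases eq_or_ne ‖w‖ 0 with h | h
    · simp [h]
    · field_simp

lemma sum_norm_le_of_forall_integral_le {Ω : Set E} (hΩ : IsOpen Ω) {μ : VectorMeasure E V}
    [IsFiniteMeasure μ.variation] (hμ : μ.variation Ωᶜ = 0) {C : ℝ}
    (h : ∀ φ : E → V, ContDiff ℝ 1 φ → HasCompactSupport φ → tsupport φ ⊆ Ω →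
      (∀ x, ‖φ x‖ ≤ 1) → ∫ᵛ x, φ x ∂[innerSL ℝ; μ] ≤ C)
    {κ : Type*} [Fintype κ] {p : κ → Set E} (hp : ∀ k, MeasurableSet (p k))
    (hd : Pairwise (Disjoint on p)) : ∑ k, ‖μ (p k)‖ ≤ C := by
  suffices hδ : ∀ δ : ℝ, 0 < δ → ∑ k, ‖μ (p k)‖ ≤ C + Fintype.card κ * δ by
    have hlim : Tendsto (fun δ : ℝ => C + Fintype.card κ * δ) (𝓝[>] 0) (𝓝 C) :=
      Tendsto.mono_left (Continuous.tendsto' (by fun_prop) _ _ (by simp)) nhdsWithin_le_nhds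
    exact ge_of_tendsto hlim (eventually_mem_nhdsWithin.mono hδ)
  intro δ hδ
  obtain ⟨χ, hχ, hχc, hχΩ, hχ01, hχd, hχp⟩ :=
    exists_contDiff_approx_indicator μ.variation hΩ hμ hp hd hδ
  choose v hv hvp using fun k => exists_norm_le_one_inner_eq_norm (μ (p k))
  have hint : ∀ k, Integrable (χ k) μ.variation := fun k =>
    (hχ k).continuous.integrable_of_hasCompactSupport (hχc k)
  have htsupport : tsupport (fun x => ∑ k, χ k x • v k) ⊆ ⋃ k, tsupport (χ k) := by
    refine closure_minimal (fun x hx => by_contra fun hcon => hx ?_)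
      (isClosed_iUnion_of_finite fun k => isClosed_tsupport _)
    refine Finset.sum_eq_zero fun k _ => ?_
    rw [image_eq_zero_of_notMem_tsupport fun hk => hcon (mem_iUnion.2 ⟨k, hk⟩), zero_smul]
  have hle : ∑ k, ∫ᵛ x, χ k x • v k ∂[innerSL ℝ; μ] ≤ C := by
    rw [← VectorMeasure.integral_finsetSum _ fun k _ => (hint k).smul_const (v k)]
    exact h _ (ContDiff.sum fun k _ => ((hχ k).of_le (by norm_cast)).smul contDiff_const)
      ((isCompact_iUnion hχc).of_isClosed_subset (isClosed_tsupport _) htsupport)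
      (htsupport.trans (iUnion_subset hχΩ)) (norm_sum_smul_le_one hχ01 hχd hv)
  have hpiece : ∀ k, ‖μ (p k)‖ ≤ ∫ᵛ x, χ k x • v k ∂[innerSL ℝ; μ] + δ := fun k => by
    have happrox := (norm_integral_smul_sub_inner_le (hint k) (hp k) (v k)).trans
      ((mul_le_of_le_one_left (integral_nonneg fun _ => abs_nonneg _) (hv k)).trans (hχp k))
    rw [hvp] at happrox
    linarith [(abs_le.1 happrox).1]
  calc ∑ k, ‖μ (p k)‖ ≤ ∑ k, (∫ᵛ x, χ k x • v k ∂[innerSL ℝ; μ] + δ) :=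
        Finset.sum_le_sum fun k _ => hpiece k
    _ ≤ C + Fintype.card κ * δ := by
        rw [Finset.sum_add_distrib, Finset.sum_const, nsmul_eq_mul, Finset.card_univ]
        gcongr

lemma variation_univ_le_of_forall_integral_le {Ω : Set E} (hΩ : IsOpen Ω) {μ : VectorMeasure E V}
    [IsFiniteMeasure μ.variation] (hμ : ∀ A, MeasurableSet A → Disjoint A Ω → μ A = 0) {C : ℝ}
    (h : ∀ φ : E → V, ContDiff ℝ 1 φ → HasCompactSupport φ → tsupport φ ⊆ Ω →
      (∀ x, ‖φ x‖ ≤ 1) → ∫ᵛ x, φ x ∂[innerSL ℝ; μ] ≤ C) :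
    μ.variation univ ≤ ENNReal.ofReal C := by
  have hΩ0 : μ.variation Ωᶜ = 0 :=
    (VectorMeasure.variation_apply_eq_zero hΩ.measurableSet.compl).2 fun t ht htm =>
      hμ t htm (disjoint_left.2 fun x hx => ht hx)
  refine ENNReal.le_of_forall_pos_le_add fun ε hε _ => ?_
  obtain ⟨P, -, hPd, hPm, hP⟩ :=
    VectorMeasure.exists_variation_le_add μ MeasurableSet.univ hε (measure_ne_top _ _)
  refine hP.trans (add_le_add_left ?_ _)
  have hsum : ∑ p : P, ‖μ p‖ ≤ C := sum_norm_le_of_forall_integral_le hΩ hΩ0 h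
    (fun p => hPm p p.2) fun p q hpq => hPd p.2 q.2 (Subtype.coe_ne_coe.2 hpq)
  rw [Finset.sum_coe_sort P fun p => ‖μ p‖] at hsum
  simpa only [ofReal_norm, ENNReal.ofReal_sum_of_nonneg fun _ _ => norm_nonneg _]
    using ENNReal.ofReal_le_ofReal hsum

lemma totalVar_univ_le_of_forall_integral_le {ι : Type*} [Fintype ι] {Ω : Set E} (hΩ : IsOpen Ω)
    {μ : ι → SignedMeasure E} (hμ : ∀ i A, MeasurableSet A → Disjoint A Ω → μ i A = 0) {C : ℝ}
    (h : ∀ φ : E → EuclideanSpace ℝ ι, ContDiff ℝ 1 φ → HasCompactSupport φ → tsupport φ ⊆ Ω →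
      (∀ x, ‖φ x‖ ≤ 1) → ∑ i, ∫ᵛ x, φ x i ∂•(μ i) ≤ C) :
    totalVar μ univ ≤ ENNReal.ofReal C := by
  refine variation_univ_le_of_forall_integral_le hΩ (fun A hA hd => ?_) fun φ hφ hc hΩφ hφ1 => ?_
  · ext i
    exact hμ i A hA hd
  · rw [integral_inner_ofComponents μ (hφ.continuous.integrable_of_hasCompactSupport hc)]
    exact h φ hφ hc hΩφ hφ1

lemma innerSL_real_eq_lsmul :
    (innerSL ℝ : ℝ →L[ℝ] ℝ →L[ℝ] ℝ) = ContinuousLinearMap.lsmul ℝ ℝ := by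
  ext x
  rw [innerSL_apply_apply]
  exact real_inner_comm _ _

lemma signedMeasure_eq_of_forall_integral_eq {Ω : Set E} (hΩ : IsOpen Ω) {μ ν : SignedMeasure E}
    (hμ : ∀ A, MeasurableSet A → Disjoint A Ω → μ A = 0)
    (hν : ∀ A, MeasurableSet A → Disjoint A Ω → ν A = 0)
    (h : ∀ ψ : E → ℝ, ContDiff ℝ 1 ψ → HasCompactSupport ψ → tsupport ψ ⊆ Ω →
      ∫ᵛ x, ψ x ∂•μ = ∫ᵛ x, ψ x ∂•ν) : μ = ν := by
  have hvar : (μ - ν).variation univ ≤ ENNReal.ofReal 0 := by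
    refine variation_univ_le_of_forall_integral_le hΩ (fun A hA hd => ?_) fun ψ hψ hc hψΩ _ => ?_
    · simp [hμ A hA hd, hν A hA hd]
    · have hint : ∀ ρ : SignedMeasure E, ρ.Integrable ψ := fun ρ =>
        hψ.continuous.integrable_of_hasCompactSupport hc
      rw [innerSL_real_eq_lsmul, VectorMeasure.integral_sub_vectorMeasure (hint μ) (hint ν),
        h ψ hψ hc hψΩ, sub_self]
  rw [← sub_eq_zero, ← VectorMeasure.variation_eq_zero]
  simpa using hvar

end Duality

section Divergence

variable {E : Type*} [NormedAddCommGroup E] [NormedSpace ℝ E]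

@[simp] lemma divergence_const (v x : E) : divergence (fun _ : E => v) x = 0 := by
  simp [divergence]

lemma divergence_sub {V W : E → E} {x : E} (hV : DifferentiableAt ℝ V x)
    (hW : DifferentiableAt ℝ W x) :
    divergence (fun y => V y - W y) x = divergence V x - divergence W x := by
  rw [divergence, fderiv_fun_sub hV hW]
  simp [divergence]

variable [FiniteDimensional ℝ E]

lemma divergence_smul {g : E → ℝ} {X : E → E} {x : E} (hg : DifferentiableAt ℝ g x)
    (hX : DifferentiableAt ℝ X x) :
    divergence (fun y => g y • X y) x = g x * divergence X x + fderiv ℝ g x (X x) := by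
  rw [divergence, fderiv_fun_smul hg hX, ContinuousLinearMap.toLinearMap_add, map_add,
    ContinuousLinearMap.toLinearMap_smul, map_smul, smul_eq_mul, divergence]
  congr 1
  exact LinearMap.trace_smulRight _ _

/-- The trace as a continuous linear functional, so that `divergence V = traceL E ∘ fderiv ℝ V`. -/
def traceL (E : Type*) [NormedAddCommGroup E] [NormedSpace ℝ E] [FiniteDimensional ℝ E] :
    (E →L[ℝ] E) →L[ℝ] ℝ :=
  LinearMap.toContinuousLinearMap (LinearMap.trace ℝ E ∘ₗ ContinuousLinearMap.coeLM ℝ)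

lemma continuous_divergence {V : E → E} (hV : ContDiff ℝ 1 V) : Continuous (divergence V) :=
  (traceL E).continuous.comp (hV.continuous_fderiv one_ne_zero)

lemma tsupport_divergence_subset (V : E → E) : tsupport (divergence V) ⊆ tsupport V :=
  (tsupport_comp_subset (g := traceL E) (map_zero _) _).trans (tsupport_fderiv_subset ℝ)

lemma hasCompactSupport_divergence {V : E → E} (hV : HasCompactSupport V) :
    HasCompactSupport (divergence V) :=
  hV.of_isClosed_subset (isClosed_tsupport _) (tsupport_divergence_subset V)

lemma tsupport_divergence_smul_subset (g : E → ℝ) (X : E → E) :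
    tsupport (divergence fun y => g y • X y) ⊆ tsupport g :=
  (tsupport_divergence_subset _).trans (closure_mono (support_smul_subset_left _ _))

lemma continuous_divergence_smul {g : E → ℝ} {X : E → E} (hg : ContDiff ℝ 1 g)
    (hX : ContDiff ℝ 1 X) : Continuous (divergence fun y => g y • X y) :=
  continuous_divergence (hg.smul hX)

lemma hasCompactSupport_divergence_smul {g : E → ℝ} (hg : HasCompactSupport g) (X : E → E) :
    HasCompactSupport (divergence fun y => g y • X y) :=
  hasCompactSupport_divergence hg.smul_right

lemma divergence_eq_sum {κ : Type*} [Fintype κ] (b : Module.Basis κ ℝ E) {V : E → E} {x : E}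
    (hV : DifferentiableAt ℝ V x) :
    divergence V x =
      ∑ i, fderiv ℝ (fun y => LinearMap.toContinuousLinearMap (b.coord i) (V y)) x (b i) := by
  classical
  rw [divergence, LinearMap.trace_eq_matrix_trace ℝ b, Matrix.trace]
  refine Finset.sum_congr rfl fun i _ => ?_
  have h : HasFDerivAt (fun y => LinearMap.toContinuousLinearMap (b.coord i) (V y))
      ((LinearMap.toContinuousLinearMap (b.coord i)).comp (fderiv ℝ V x)) x :=
    (LinearMap.toContinuousLinearMap (b.coord i)).hasFDerivAt.comp x hV.hasFDerivAt
  rw [h.fderiv, Matrix.diag_apply, LinearMap.toMatrix_apply]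
  rfl

variable [MeasurableSpace E] [BorelSpace E] (μ : Measure E)

lemma integrable_divergence_smul [IsFiniteMeasureOnCompacts μ] {g : E → ℝ} {X : E → E}
    (hg : ContDiff ℝ 1 g) (hc : HasCompactSupport g) (hX : ContDiff ℝ 1 X) :
    Integrable (divergence fun y => g y • X y) μ :=
  (continuous_divergence_smul hg hX).integrable_of_hasCompactSupport
    (hasCompactSupport_divergence_smul hc X)

variable [μ.IsAddHaarMeasure]

omit [FiniteDimensional ℝ E] in
lemma integrable_fderiv_apply [LocallyCompactSpace E] {g : E → ℝ}
    (hg : ContDiff ℝ 1 g) (hc : HasCompactSupport g) (v : E) :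
    Integrable (fun x => fderiv ℝ g x v) μ :=
  ((hg.continuous_fderiv one_ne_zero).clm_apply continuous_const).integrable_of_hasCompactSupport
    (hc.fderiv_apply ℝ v)

lemma integral_fderiv_apply_eq_zero {g : E → ℝ} (hg : ContDiff ℝ 1 g) (hc : HasCompactSupport g)
    (v : E) : ∫ x, fderiv ℝ g x v ∂μ = 0 := by
  simpa using integral_mul_fderiv_eq_neg_fderiv_mul_of_integrable (𝕜 := ℝ) (μ := μ) (v := v)
    (f := fun _ => (1 : ℝ)) (g := g) (by simp) (by simpa using integrable_fderiv_apply μ hg hc v)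
    (by simpa using hg.continuous.integrable_of_hasCompactSupport hc)
    (fun x _ => by fun_prop) (fun x _ => hg.differentiable one_ne_zero x)

lemma integral_divergence_eq_zero {V : E → E} (hV : ContDiff ℝ 1 V) (hc : HasCompactSupport V) :
    ∫ x, divergence V x ∂μ = 0 := by
  let b := Module.finBasis ℝ E
  let c i : E →L[ℝ] ℝ := LinearMap.toContinuousLinearMap (b.coord i)
  have hcV i : ContDiff ℝ 1 fun y => c i (V y) := (c i).contDiff.comp hV
  have hcc i : HasCompactSupport fun y => c i (V y) := hc.comp_left (g := c i) (map_zero _)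
  simp_rw [fun x => divergence_eq_sum b (hV.differentiable one_ne_zero x)]
  rw [integral_finsetSum _ fun i _ => integrable_fderiv_apply μ (hcV i) (hcc i) (b i)]
  exact Finset.sum_eq_zero fun i _ => integral_fderiv_apply_eq_zero μ (hcV i) (hcc i) _

end Divergence

section WeakDeriv

variable {E : Type*} [NormedAddCommGroup E] [NormedSpace ℝ E] [MeasureSpace E]

/-- `μ` is the distributional derivative of `u` along the vector field `Y` on `Ω`. This is the
scalar counterpart of `IsHDeriv`, without the requirement that `μ` vanish off `Ω`. -/
def HasWeakDeriv (Y : E → E) (Ω : Set E) (u : E → ℝ) (μ : SignedMeasure E) : Prop :=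
  ∀ ψ : E → ℝ, ContDiff ℝ 1 ψ → HasCompactSupport ψ → tsupport ψ ⊆ Ω →
    ∫ᵛ x, ψ x ∂•μ = -∫ x in Ω, u x * divergence (fun y => ψ y • Y y) x

omit [MeasureSpace E] in
lemma smul_eq_smul_of_tsupport_subset {Ω : Set E} {Y Z : E → E} (hYZ : EqOn Y Z Ω) {ψ : E → ℝ}
    (hψ : tsupport ψ ⊆ Ω) : (fun y => ψ y • Y y) = fun y => ψ y • Z y := by
  funext y
  by_cases hy : y ∈ Ω
  · rw [hYZ hy]
  · rw [image_eq_zero_of_notMem_tsupport fun h => hy (hψ h), zero_smul, zero_smul]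

lemma HasWeakDeriv.congr_field {Ω : Set E} {Y Z : E → E} (hYZ : EqOn Y Z Ω)
    {u : E → ℝ} {μ : SignedMeasure E} (h : HasWeakDeriv Y Ω u μ) : HasWeakDeriv Z Ω u μ := by
  intro ψ hψ hc ht
  rw [h ψ hψ hc ht, smul_eq_smul_of_tsupport_subset hYZ ht]

lemma hasWeakDeriv_congr_ae {Ω : Set E} {Y : E → E} {u v : E → ℝ}
    (huv : u =ᵐ[volume.restrict Ω] v) {μ : SignedMeasure E} :
    HasWeakDeriv Y Ω u μ ↔ HasWeakDeriv Y Ω v μ := by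
  refine forall_congr' fun ψ => forall₃_congr fun _ _ _ => ?_
  have h : ∫ x in Ω, u x * divergence (fun y => ψ y • Y y) x =
      ∫ x in Ω, v x * divergence (fun y => ψ y • Y y) x :=
    integral_congr_ae (huv.mono fun x hx => by simp only [hx])
  rw [h]

variable {ι : Type*} [Fintype ι]

omit [MeasureSpace E] in
lemma divX_single [DecidableEq ι] (X : ι → E → E) (ψ : E → ℝ) (i : ι) (x : E) :
    divX X (fun y => EuclideanSpace.single i (ψ y)) x = divergence (fun y => ψ y • X i y) x := by
  rw [divX, Finset.sum_eq_single i (fun j _ hj => by simp [hj]) (by simp)]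
  simp

lemma IsHDeriv.hasWeakDeriv {X : ι → E → E} {Ω : Set E} {u : E → ℝ} {D : ι → SignedMeasure E}
    (h : IsHDeriv X Ω u D) (i : ι) : HasWeakDeriv (X i) Ω u (D i) := by
  classical
  intro ψ hψ hc ht
  let single : ℝ →L[ℝ] EuclideanSpace ℝ ι :=
    ContinuousLinearMap.toSpanSingleton ℝ (EuclideanSpace.single i 1)
  have hsingle r : single r = EuclideanSpace.single i r := by
    ext j
    simp [single]
  have hφ := h.integral_eq (fun x => single (ψ x)) (single.contDiff.comp hψ)
    (hc.comp_left (map_zero single)) ((tsupport_comp_subset (map_zero single) ψ).trans ht)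
  simp only [hsingle, divX_single] at hφ
  rw [← hφ, Finset.sum_eq_single i (fun j _ hj => by simp [hj]) (by simp)]
  simp

variable [FiniteDimensional ℝ E] [BorelSpace E]

omit [NormedSpace ℝ E] [FiniteDimensional ℝ E] in
lemma integrableOn_mul_of_tsupport_subset {Ω : Set E} (hΩ : IsOpen Ω) {u g : E → ℝ}
    (hu : LocallyIntegrableOn u Ω) (hg : Continuous g) (hc : HasCompactSupport g)
    (ht : tsupport g ⊆ Ω) : IntegrableOn (fun x => u x * g x) Ω := by
  have h : IntegrableOn (fun x => u x * g x) (tsupport g) :=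
    (hu.integrableOn_compact_subset ht hc).mul_continuousOn hg.continuousOn hc
  refine h.of_forall_sdiff_eq_zero hΩ.measurableSet fun x hx => ?_
  rw [image_eq_zero_of_notMem_tsupport hx.2, mul_zero]

lemma isHDeriv_iff {X : ι → E → E} (hX : ∀ i, ContDiff ℝ 1 (X i))
    {Ω : Set E} (hΩ : IsOpen Ω) {u : E → ℝ} (hu : LocallyIntegrableOn u Ω)
    {D : ι → SignedMeasure E} :
    IsHDeriv X Ω u D ↔ (∀ i A, MeasurableSet A → Disjoint A Ω → D i A = 0) ∧
      ∀ i, HasWeakDeriv (X i) Ω u (D i) := by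
  refine ⟨fun h => ⟨h.concentrated, h.hasWeakDeriv⟩, fun ⟨hD, h⟩ =>
    ⟨hD, measure_lt_top _ _, fun φ hφ hφc hφt => ?_⟩⟩
  have hφi i : ContDiff ℝ 1 fun x => φ x i := by fun_prop
  have hci i : HasCompactSupport fun x => φ x i :=
    hφc.comp_left (g := fun v : EuclideanSpace ℝ ι => v i) rfl
  have hti i : tsupport (fun x => φ x i) ⊆ Ω :=
    (tsupport_comp_subset (g := fun v : EuclideanSpace ℝ ι => v i) rfl φ).trans hφt
  have hint i : IntegrableOn (fun x => u x * divergence (fun y => φ y i • X i y) x) Ω :=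
    integrableOn_mul_of_tsupport_subset hΩ hu (continuous_divergence_smul (hφi i) (hX i))
      (hasCompactSupport_divergence_smul (hci i) _)
      ((tsupport_divergence_smul_subset _ _).trans (hti i))
  simp_rw [divX, Finset.mul_sum]
  rw [integral_finsetSum _ fun i _ => hint i, ← Finset.sum_neg_distrib]
  exact Finset.sum_congr rfl fun i _ => h i _ (hφi i) (hci i) (hti i)

end WeakDeriv

section Slices

variable {E : Type*} [TopologicalSpace E] {β : Type*} [Zero β]
  {φ : E × ℝ → β}

lemma hasCompactSupport_slice_fst [R1Space E] (hφ : HasCompactSupport φ) (s : ℝ) :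
    HasCompactSupport fun x => φ (x, s) :=
  .intro (hφ.isCompact.image continuous_fst) fun _ hx =>
    image_eq_zero_of_notMem_tsupport fun h => hx ⟨_, h, rfl⟩

lemma hasCompactSupport_slice_snd (hφ : HasCompactSupport φ) (x : E) :
    HasCompactSupport fun t => φ (x, t) :=
  .intro (hφ.isCompact.image continuous_snd) fun _ ht =>
    image_eq_zero_of_notMem_tsupport fun h => ht ⟨_, h, rfl⟩

end Slices

section HorizontalLift

variable {E : Type*} [NormedAddCommGroup E] [NormedSpace ℝ E]

/-- The horizontal lift `X̃ (x, t) = (X x, 0)` to `E × ℝ` of a vector field `X` on `E`. -/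
def horizontalLift (X : E → E) (p : E × ℝ) : E × ℝ := (X p.1, 0)

lemma contDiff_horizontalLift {X : E → E} (hX : ContDiff ℝ 1 X) :
    ContDiff ℝ 1 (horizontalLift X) :=
  (hX.comp contDiff_fst).prodMk contDiff_const

lemma smul_horizontalLift (φ : E × ℝ → ℝ) (X : E → E) (p : E × ℝ) :
    φ p • horizontalLift X p = (φ p • X p.1, 0) := by
  simp [horizontalLift]

variable [FiniteDimensional ℝ E]

lemma divergence_prodMk_zero {V : E × ℝ → E} {x : E} {t : ℝ}
    (hV : DifferentiableAt ℝ V (x, t)) :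
    divergence (fun q => (V q, (0 : ℝ))) (x, t) = divergence (fun y => V (y, t)) x := by
  have h : HasFDerivAt (fun q => (V q, (0 : ℝ)))
      ((ContinuousLinearMap.inl ℝ E ℝ).comp (fderiv ℝ V (x, t))) (x, t) :=
    (ContinuousLinearMap.inl ℝ E ℝ).hasFDerivAt.comp (x, t) hV.hasFDerivAt
  have hslice : HasFDerivAt (fun y => V (y, t))
      ((fderiv ℝ V (x, t)).comp (ContinuousLinearMap.inl ℝ E ℝ)) x :=
    HasFDerivAt.comp x (f := fun y => (y, t)) hV.hasFDerivAt (hasFDerivAt_prodMk_left x t)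
  rw [divergence, h.fderiv, divergence, hslice.fderiv, ContinuousLinearMap.toLinearMap_comp,
    ContinuousLinearMap.toLinearMap_comp, LinearMap.trace_comp_comm']

lemma divergence_smul_horizontalLift_eq_slice {X : E → E} {φ : E × ℝ → ℝ} {x : E} {t : ℝ}
    (hφ : DifferentiableAt ℝ φ (x, t)) (hX : DifferentiableAt ℝ X x) :
    divergence (fun q => φ q • horizontalLift X q) (x, t) =
      divergence (fun y => φ (y, t) • X y) x := by
  simp only [smul_horizontalLift]
  exact divergence_prodMk_zero (V := fun q => φ q • X q.1)
    (hφ.fun_smul (hX.comp (x, t) differentiableAt_fst))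

lemma divergence_smul_horizontalLift {X : E → E} {φ : E × ℝ → ℝ} {x : E} {t : ℝ}
    (hφ : DifferentiableAt ℝ φ (x, t)) (hX : DifferentiableAt ℝ X x) :
    divergence (fun q => φ q • horizontalLift X q) (x, t) =
      φ (x, t) * divergence X x + fderiv ℝ φ (x, t) (X x, 0) := by
  have hlift : DifferentiableAt ℝ (horizontalLift X) (x, t) :=
    (hX.comp (x, t) differentiableAt_fst).prodMk (differentiableAt_const _)
  have hdiv : divergence (horizontalLift X) (x, t) = divergence X x :=
    divergence_prodMk_zero (hX.comp (x, t) differentiableAt_fst)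
  rw [divergence_smul hφ hlift, hdiv, horizontalLift]

lemma divergence_smul_vertical {φ : E × ℝ → ℝ} {p : E × ℝ} (hφ : DifferentiableAt ℝ φ p) :
    divergence (fun q => φ q • ((0, 1) : E × ℝ)) p = fderiv ℝ φ p (0, 1) := by
  rw [divergence_smul hφ (differentiableAt_const _), divergence_const, mul_zero, zero_add]

end HorizontalLift

section Undergraph

variable {E : Type*}

/-- The undergraph `{(x, t) : t < v x}` of `v` over the whole space. -/
def undergraph (v : E → ℝ) : Set (E × ℝ) := {p | p.2 < v p.1}

lemma measurableSet_undergraph [MeasurableSpace E] {v : E → ℝ} (hv : Measurable v) :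
    MeasurableSet (undergraph v) :=
  measurableSet_lt measurable_snd (hv.comp measurable_fst)

lemma setIntegral_Iio_eq_integral_indicator (v : E → ℝ) (G : E × ℝ → ℝ) (x : E) :
    ∫ t in Iio (v x), G (x, t) = ∫ t, (undergraph v).indicator G (x, t) := by
  rw [← integral_indicator measurableSet_Iio]
  rfl

variable [MeasureSpace E] {v : E → ℝ} {G : E × ℝ → ℝ}

lemma setIntegral_undergraph [SFinite (volume : Measure E)] (hv : Measurable v)
    (hG : Integrable G) :
    ∫ p in undergraph v, G p = ∫ x, ∫ t in Iio (v x), G (x, t) := by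
  simp_rw [setIntegral_Iio_eq_integral_indicator]
  rw [← integral_indicator (measurableSet_undergraph hv), Measure.volume_eq_prod,
    integral_prod _ (hG.indicator (measurableSet_undergraph hv))]

lemma integrable_setIntegral_Iio (hv : Measurable v) (hG : Integrable G) :
    Integrable fun x => ∫ t in Iio (v x), G (x, t) := by
  simp_rw [setIntegral_Iio_eq_integral_indicator]
  exact (hG.indicator (measurableSet_undergraph hv)).integral_prod_left

lemma abs_setIntegral_Iio_sub_le {g : ℝ → ℝ} (hg : Integrable g) {M : ℝ} (hM : ∀ t, |g t| ≤ M)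
    (a b : ℝ) : |(∫ t in Iio a, g t) - ∫ t in Iio b, g t| ≤ M * |a - b| := by
  rw [intervalIntegral.integral_Iio_sub_Iio' hg.integrableOn hg.integrableOn, ← Real.norm_eq_abs]
  exact intervalIntegral.norm_integral_le_of_norm_le_const fun t _ => hM t

lemma tendsto_setIntegral_undergraph [SFinite (volume : Measure E)] [TopologicalSpace E]
    [OpensMeasurableSpace E] [SecondCountableTopology E]
    [IsFiniteMeasureOnCompacts (volume : Measure E)]
    (hv : Measurable v) (hvi : Integrable v) {w : ℕ → E → ℝ} (hw : ∀ k, Measurable (w k))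
    (hwi : ∀ k, Integrable (w k)) (hwv : Tendsto (fun k => ∫ x, |w k x - v x|) atTop (𝓝 0))
    (hG : Continuous G) (hGc : HasCompactSupport G) :
    Tendsto (fun k => ∫ p in undergraph (w k), G p) atTop (𝓝 (∫ p in undergraph v, G p)) := by
  have hGi : Integrable G := hG.integrable_of_hasCompactSupport hGc
  obtain ⟨M, hM⟩ := hG.bounded_above_of_compact_support hGc
  have hslice x : Integrable fun t => G (x, t) :=
    (hG.comp (by fun_prop : Continuous fun t : ℝ => (x, t))).integrable_of_hasCompactSupport
      (hasCompactSupport_slice_snd hGc x)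
  simp_rw [fun k => setIntegral_undergraph (hw k) hGi, setIntegral_undergraph hv hGi]
  rw [tendsto_iff_norm_sub_tendsto_zero]
  refine squeeze_zero (fun _ => norm_nonneg _) (fun k => ?_) (by simpa using hwv.const_mul M)
  rw [← integral_sub (integrable_setIntegral_Iio (hw k) hGi) (integrable_setIntegral_Iio hv hGi),
    ← integral_const_mul]
  exact norm_integral_le_of_norm_le (((hwi k).sub hvi).abs.const_mul M)
    (Eventually.of_forall fun x =>
      abs_setIntegral_Iio_sub_le (hslice x) (fun t => hM (x, t)) (w k x) (v x))

end Undergraph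

section ChainRule

variable {E : Type*} [NormedAddCommGroup E] [NormedSpace ℝ E]

/-- The shear `(x, s) ↦ (x, v x + s)`, which maps `E × Iio 0` onto the undergraph of `v`. -/
def shear {F : Type*} [TopologicalSpace F] (v : F → ℝ) (hv : Continuous v) : F × ℝ ≃ₜ F × ℝ where
  toFun p := (p.1, v p.1 + p.2)
  invFun p := (p.1, p.2 - v p.1)
  left_inv p := by simp
  right_inv p := by simp
  continuous_toFun := by fun_prop
  continuous_invFun := by fun_prop

lemma hasCompactSupport_comp_shear {F : Type*} [TopologicalSpace F] {v : F → ℝ}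
    (hv : Continuous v) {β : Type*} [Zero β] {φ : F × ℝ → β} (hφ : HasCompactSupport φ) :
    HasCompactSupport fun p : F × ℝ => φ (p.1, v p.1 + p.2) :=
  hφ.comp_homeomorph (shear v hv)

lemma setIntegral_Iio_eq_shift (g : ℝ → ℝ) (a : ℝ) :
    ∫ t in Iio a, g t = ∫ s in Iio 0, g (a + s) := by
  rw [← (measurePreserving_add_left volume a).setIntegral_preimage_emb
    (measurableEmbedding_addLeft a)]
  simp

lemma integral_Iio_fderiv_vertical {φ : E × ℝ → ℝ} (hφ : ContDiff ℝ 1 φ)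
    (hc : HasCompactSupport φ) (x : E) (a : ℝ) :
    ∫ t in Iio a, fderiv ℝ φ (x, t) (0, 1) = φ (x, a) := by
  have hd t : HasDerivAt (fun t => φ (x, t)) (fderiv ℝ φ (x, t) (0, 1)) t :=
    (hφ.differentiable one_ne_zero (x, t)).hasFDerivAt.comp_hasDerivAt t
      ((hasDerivAt_const t x).prodMk (hasDerivAt_id t))
  have hslice : ContDiff ℝ 1 fun t => φ (x, t) := hφ.comp (by fun_prop)
  rw [← integral_Iic_eq_integral_Iio,
    ← (hasCompactSupport_slice_snd hc x).integral_Iic_deriv_eq hslice a]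
  exact integral_congr_ae (Eventually.of_forall fun t => (hd t).deriv.symm)

lemma fderiv_comp_shear_apply {v : E → ℝ} {φ : E × ℝ → ℝ} {x : E} {s : ℝ}
    (hv : DifferentiableAt ℝ v x) (hφ : DifferentiableAt ℝ φ (x, v x + s)) (w : E) :
    fderiv ℝ (fun p : E × ℝ => φ (p.1, v p.1 + p.2)) (x, s) (w, 0) =
      fderiv ℝ φ (x, v x + s) (w, 0) + fderiv ℝ φ (x, v x + s) (0, 1) * fderiv ℝ v x w := by
  have hshear : HasFDerivAt (fun p : E × ℝ => (p.1, v p.1 + p.2))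
      ((ContinuousLinearMap.fst ℝ E ℝ).prod
        ((fderiv ℝ v x).comp (ContinuousLinearMap.fst ℝ E ℝ) + ContinuousLinearMap.snd ℝ E ℝ))
      (x, s) :=
    hasFDerivAt_fst.prodMk ((hv.hasFDerivAt.comp (x, s) hasFDerivAt_fst).add hasFDerivAt_snd)
  have hcomp : HasFDerivAt (fun p : E × ℝ => φ (p.1, v p.1 + p.2)) _ (x, s) :=
    HasFDerivAt.comp (x, s) (g := φ) hφ.hasFDerivAt hshear
  have hsplit : ((w, fderiv ℝ v x w) : E × ℝ) = (w, 0) + fderiv ℝ v x w • (0, 1) := by simp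
  rw [hcomp.fderiv]
  simp only [ContinuousLinearMap.comp_apply, ContinuousLinearMap.prod_apply, add_apply,
    ContinuousLinearMap.coe_fst', ContinuousLinearMap.coe_snd', add_zero, hsplit, map_add,
    map_smul, smul_eq_mul, mul_comm]

variable [FiniteDimensional ℝ E]

lemma divergence_smul_horizontalLift_comp_shear {v : E → ℝ} {X : E → E} {φ : E × ℝ → ℝ} {x : E}
    {s : ℝ} (hv : DifferentiableAt ℝ v x) (hX : DifferentiableAt ℝ X x)
    (hφ : DifferentiableAt ℝ φ (x, v x + s)) :
    divergence (fun q => φ (q.1, v q.1 + q.2) • horizontalLift X q) (x, s) =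
      divergence (fun q => φ q • horizontalLift X q) (x, v x + s) +
        fderiv ℝ φ (x, v x + s) (0, 1) * fderiv ℝ v x (X x) := by
  have hcomp : DifferentiableAt ℝ (fun p : E × ℝ => φ (p.1, v p.1 + p.2)) (x, s) :=
    DifferentiableAt.comp (x, s) (g := φ) hφ (by fun_prop)
  rw [divergence_smul_horizontalLift hcomp hX, fderiv_comp_shear_apply hv hφ,
    divergence_smul_horizontalLift hφ hX, add_assoc]

variable [MeasureSpace E] [BorelSpace E] [(volume : Measure E).IsAddHaarMeasure]

lemma integral_setIntegral_divergence_horizontalLift_eq_zero {X : E → E} (hX : ContDiff ℝ 1 X)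
    {φ : E × ℝ → ℝ} (hφ : ContDiff ℝ 1 φ) (hc : HasCompactSupport φ) (S : Set ℝ) :
    ∫ x, ∫ s in S, divergence (fun q => φ q • horizontalLift X q) (x, s) = 0 := by
  have hint : Integrable (divergence fun q => φ q • horizontalLift X q)
      ((volume : Measure E).prod (volume.restrict S)) :=
    (integrable_divergence_smul volume hφ hc (contDiff_horizontalLift hX)).mono_measure
      (Measure.prod_mono le_rfl Measure.restrict_le_self)
  rw [integral_integral_swap
    (f := fun x s => divergence (fun q => φ q • horizontalLift X q) (x, s)) hint]
  refine integral_eq_zero_of_ae (Eventually.of_forall fun s => ?_)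
  simp_rw [fun x => divergence_smul_horizontalLift_eq_slice
    (hφ.differentiable one_ne_zero (x, s)) (hX.differentiable one_ne_zero x)]
  exact integral_divergence_eq_zero volume
    (ContDiff.smul (hφ.comp (by fun_prop : ContDiff ℝ 1 fun x : E => (x, s))) hX)
    (hasCompactSupport_slice_fst hc s).smul_right

lemma setIntegral_undergraph_divergence_vertical {v : E → ℝ} (hv : Measurable v)
    {φ : E × ℝ → ℝ} (hφ : ContDiff ℝ 1 φ) (hc : HasCompactSupport φ) :
    ∫ p in undergraph v, divergence (fun q => φ q • ((0, 1) : E × ℝ)) p = ∫ x, φ (x, v x) := by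
  rw [setIntegral_undergraph hv (integrable_divergence_smul volume hφ hc contDiff_const)]
  simp_rw [fun p => divergence_smul_vertical (hφ.differentiable one_ne_zero p),
    integral_Iio_fderiv_vertical hφ hc]

-- After shearing the undergraph onto `E × Iio 0`, the slices of the sheared field have zero total
-- divergence, and only the correction from the chain rule survives.
lemma setIntegral_undergraph_divergence_horizontalLift {v : E → ℝ} (hv : ContDiff ℝ 1 v)
    {X : E → E} (hX : ContDiff ℝ 1 X) {φ : E × ℝ → ℝ} (hφ : ContDiff ℝ 1 φ)
    (hc : HasCompactSupport φ) :
    ∫ p in undergraph v, divergence (fun q => φ q • horizontalLift X q) p =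
      -∫ x, φ (x, v x) * fderiv ℝ v x (X x) := by
  have hX' : ContDiff ℝ 1 (horizontalLift X) := contDiff_horizontalLift hX
  let H : E × ℝ → ℝ := fun p => φ (p.1, v p.1 + p.2)
  let A : E × ℝ → ℝ := divergence fun q => H q • horizontalLift X q
  let B : E × ℝ → ℝ := fun p => fderiv ℝ φ (p.1, v p.1 + p.2) (0, 1) * fderiv ℝ v p.1 (X p.1)
  have hH : ContDiff ℝ 1 H := hφ.comp
    (by fun_prop : ContDiff ℝ 1 fun p : E × ℝ => (p.1, v p.1 + p.2))
  have hHc : HasCompactSupport H := hasCompactSupport_comp_shear hv.continuous hc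
  have hle : (volume : Measure E).prod (volume.restrict (Iio (0 : ℝ))) ≤ volume :=
    Measure.prod_mono le_rfl Measure.restrict_le_self
  have hA : Integrable A ((volume : Measure E).prod (volume.restrict (Iio 0))) :=
    (integrable_divergence_smul volume hH hHc hX').mono_measure hle
  have hB : Integrable B ((volume : Measure E).prod (volume.restrict (Iio 0))) := by
    refine (Continuous.integrable_of_hasCompactSupport ?_ (hasCompactSupport_comp_shear
      hv.continuous (hc.fderiv_apply ℝ (0, 1))).mul_right).mono_measure hle
    have := hφ.continuous_fderiv one_ne_zero
    have := hv.continuous_fderiv one_ne_zero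
    have := hv.continuous
    have := hX.continuous
    fun_prop
  calc ∫ p in undergraph v, divergence (fun q => φ q • horizontalLift X q) p
      = ∫ x, ∫ s in Iio 0, A (x, s) - B (x, s) := by
        rw [setIntegral_undergraph hv.continuous.measurable
          (integrable_divergence_smul volume hφ hc hX')]
        refine integral_congr_ae (Eventually.of_forall fun x => ?_)
        simp only [setIntegral_Iio_eq_shift _ (v x), A, B, H,
          divergence_smul_horizontalLift_comp_shear (hv.differentiable one_ne_zero _)
            (hX.differentiable one_ne_zero _) (hφ.differentiable one_ne_zero _),
          add_sub_cancel_right]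
    _ = -∫ x, ∫ s in Iio 0, B (x, s) := by
        rw [integral_integral_sub hA hB,
          integral_setIntegral_divergence_horizontalLift_eq_zero hX hH hHc, zero_sub]
    _ = -∫ x, φ (x, v x) * fderiv ℝ v x (X x) := by
        simp only [B, integral_mul_const, integral_Iio_fderiv_vertical hφ hc,
          ← fun x => setIntegral_Iio_eq_shift (fun t => fderiv ℝ φ (x, t) (0, 1)) (v x)]

end ChainRule

section Oscillation

variable {E : Type*} [NormedAddCommGroup E] [NormedSpace ℝ E] [FiniteDimensional ℝ E]
  [MeasureSpace E] [BorelSpace E] [(volume : Measure E).IsAddHaarMeasure] {u : E → ℝ}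

lemma tendsto_lintegral_enorm_translate_sub (hu : Integrable u) :
    Tendsto (fun z => ∫⁻ x, ‖u (x - z) - u x‖ₑ) (𝓝 0) (𝓝 0) := by
  have : Fact ((1 : ℝ≥0∞) ≠ ⊤) := ⟨ENNReal.one_ne_top⟩
  let f : Lp ℝ 1 (volume : Measure E) := (memLp_one_iff_integrable.2 hu).toLp u
  have hmk : Continuous fun z : E => DomAddAct.mk (-z) :=
    DomAddAct.continuous_mk.comp continuous_neg
  have hdist : Tendsto (fun z : E => edist (DomAddAct.mk (-z) +ᵥ f) f) (𝓝 0) (𝓝 0) := by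
    simpa using ((hmk.vadd (continuous_const (y := f))).edist (continuous_const (y := f))).tendsto 0
  refine hdist.congr fun z => ?_
  rw [DomAddAct.mk_vadd_toLp, Lp.edist_toLp_toLp, eLpNorm_one_eq_lintegral_enorm]
  exact lintegral_congr fun x => by simp [sub_eq_neg_add]

lemma tendsto_lintegral_mul_enorm_translate_sub (hum : Measurable u) (hu : Integrable u)
    {α : Type*} {l : Filter α} {κ : α → E → ℝ≥0∞} (hκm : ∀ a, Measurable (κ a)) {C : ℝ≥0∞}
    (hC : C ≠ ⊤) (hκ : ∀ a, ∫⁻ z, κ a z ≤ C)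
    (hsupp : Tendsto (fun a => support (κ a)) l (𝓝 0).smallSets) :
    Tendsto (fun a => ∫⁻ x, ∫⁻ z, κ a z * ‖u (x - z) - u x‖ₑ) l (𝓝 0) := by
  rw [ENNReal.tendsto_nhds_zero]
  intro η hη
  have hpos : 0 < η / (C + 1) := ENNReal.div_pos hη.ne' (by finiteness)
  filter_upwards [hsupp.eventually (eventually_smallSets.2 ⟨_, ENNReal.tendsto_nhds_zero.1
    (tendsto_lintegral_enorm_translate_sub hu) _ hpos, fun _ h => h⟩)] with a ha
  have hκa := hκm a
  calc ∫⁻ x, ∫⁻ z, κ a z * ‖u (x - z) - u x‖ₑ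
      = ∫⁻ z, ∫⁻ x, κ a z * ‖u (x - z) - u x‖ₑ := by
        refine lintegral_lintegral_swap (Measurable.aemeasurable ?_)
        simp only [uncurry_def]
        fun_prop
    _ = ∫⁻ z, κ a z * ∫⁻ x, ‖u (x - z) - u x‖ₑ :=
        lintegral_congr fun z => lintegral_const_mul _ (by fun_prop)
    _ ≤ ∫⁻ z, κ a z * (η / (C + 1)) := by
        refine lintegral_mono fun z => ?_
        by_cases hz : κ a z = 0
        · simp [hz]
        · exact mul_le_mul_right (ha hz) _
    _ = (∫⁻ z, κ a z) * (η / (C + 1)) := lintegral_mul_const _ hκa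
    _ ≤ (C + 1) * (η / (C + 1)) := by gcongr; exact (hκ a).trans le_self_add
    _ ≤ η := ENNReal.mul_div_le

lemma tendsto_lintegral_enorm_kernel_integral (hum : Measurable u) (hu : Integrable u)
    {α : Type*} {l : Filter α} {κ : α → E → ℝ≥0∞} (hκm : ∀ a, Measurable (κ a)) {C : ℝ≥0∞}
    (hC : C ≠ ⊤) (hκ : ∀ a, ∫⁻ z, κ a z ≤ C)
    (hsupp : Tendsto (fun a => support (κ a)) l (𝓝 0).smallSets) {q : α → E → E → ℝ}
    (hq : ∀ a x y, ‖q a x y‖ₑ ≤ κ a (x - y)) :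
    Tendsto (fun a => ∫⁻ x, ‖∫ y, (u y - u x) * q a x y‖ₑ) l (𝓝 0) := by
  refine tendsto_of_tendsto_of_tendsto_of_le_of_le tendsto_const_nhds
    (tendsto_lintegral_mul_enorm_translate_sub hum hu hκm hC hκ hsupp) (fun _ => zero_le)
    fun a => lintegral_mono fun x => ?_
  calc ‖∫ y, (u y - u x) * q a x y‖ₑ
      ≤ ∫⁻ y, ‖(u y - u x) * q a x y‖ₑ := enorm_integral_le_lintegral_enorm _
    _ ≤ ∫⁻ y, κ a (x - y) * ‖u y - u x‖ₑ := by
        refine lintegral_mono fun y => ?_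
        rw [enorm_mul, mul_comm]
        gcongr
        exact hq a x y
    _ = ∫⁻ z, κ a z * ‖u (x - z) - u x‖ₑ := by
        rw [← lintegral_sub_left_eq_self _ x]
        simp only [sub_sub_cancel]

end Oscillation

section Dilation

variable {E : Type*} [NormedAddCommGroup E] [NormedSpace ℝ E]

/-- The `L¹`-normalized dilation `ρ_ε(z) = ε⁻ⁿ ρ(z / ε)`, where `n` is the dimension of `E`. -/
def dilate (ε : ℝ) (ρ : E → ℝ) (z : E) : ℝ :=
  (ε⁻¹) ^ Module.finrank ℝ E * ρ (ε⁻¹ • z)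

variable {ε : ℝ} {ρ : E → ℝ}

lemma contDiff_dilate (hρ : ContDiff ℝ 1 ρ) (ε : ℝ) : ContDiff ℝ 1 (dilate ε ρ) := by
  unfold dilate
  fun_prop

lemma tsupport_dilate_subset (hε : 0 < ε) {r : ℝ} (hρ : tsupport ρ ⊆ Metric.closedBall 0 r) :
    tsupport (dilate ε ρ) ⊆ Metric.closedBall 0 (ε * r) := by
  refine closure_minimal (fun z hz => ?_) Metric.isClosed_closedBall
  have hz' : ε⁻¹ • z ∈ Metric.closedBall 0 r :=
    hρ (subset_tsupport ρ fun h => hz (by rw [dilate, h, mul_zero]))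
  rwa [mem_closedBall_zero_iff, norm_smul, norm_inv, Real.norm_of_nonneg hε.le,
    inv_mul_le_iff₀ hε, ← mem_closedBall_zero_iff] at hz'

lemma norm_fderiv_dilate_mul_norm (hε : 0 < ε) (hρ : ContDiff ℝ 1 ρ) (z : E) :
    ‖fderiv ℝ (dilate ε ρ) z‖ * ‖z‖ = dilate ε (fun z => ‖fderiv ℝ ρ z‖ * ‖z‖) z := by
  have h : HasFDerivAt (dilate ε ρ) (((ε⁻¹) ^ Module.finrank ℝ E) •
      (fderiv ℝ ρ (ε⁻¹ • z)).comp (ε⁻¹ • ContinuousLinearMap.id ℝ E)) z :=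
    ((hρ.differentiable one_ne_zero (ε⁻¹ • z)).hasFDerivAt.comp z
      ((hasFDerivAt_id z).const_smul ε⁻¹)).const_mul _
  rw [h.fderiv, ContinuousLinearMap.comp_smul, ContinuousLinearMap.comp_id, norm_smul, norm_smul,
    dilate, norm_smul, Real.norm_of_nonneg (by positivity), Real.norm_of_nonneg (by positivity)]
  ring

lemma integral_dilate [FiniteDimensional ℝ E] [MeasureSpace E] [BorelSpace E]
    [(volume : Measure E).IsAddHaarMeasure] (hε : 0 < ε) (ρ : E → ℝ) :
    ∫ z, dilate ε ρ z = ∫ z, ρ z := by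
  simp only [dilate]
  rw [integral_const_mul, Measure.integral_comp_inv_smul, abs_of_pos (by positivity), smul_eq_mul,
    ← mul_assoc, ← mul_pow, inv_mul_cancel₀ hε.ne', one_pow, one_mul]

end Dilation

section Mollifiers

variable {E : Type*} [NormedAddCommGroup E] [NormedSpace ℝ E] [MeasureSpace E]

/-- A `C¹` probability density with compact support, used as a convolution kernel. -/
structure IsMollifier (ρ : E → ℝ) : Prop where
  contDiff : ContDiff ℝ 1 ρ
  hasCompactSupport : HasCompactSupport ρ
  nonneg : ∀ z, 0 ≤ ρ z
  integral_eq_one : ∫ z, ρ z = 1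

/-- A sequence of mollifiers concentrating at the origin. The uniform bound on the first moments of
the gradients, which holds for the dilations of a fixed density, is what Friedrichs' commutator
estimate requires. -/
structure IsMollifierSequence (ρ : ℕ → E → ℝ) : Prop where
  isMollifier : ∀ k, IsMollifier (ρ k)
  tendsto_tsupport : Tendsto (fun k => tsupport (ρ k)) atTop (𝓝 0).smallSets
  exists_fderiv_bound : ∃ C : ℝ≥0, ∀ k, ∫⁻ z, ‖fderiv ℝ (ρ k) z‖ₑ * ‖z‖ₑ ≤ C

namespace IsMollifierSequence

variable {ρ : ℕ → E → ℝ} (hρ : IsMollifierSequence ρ)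
include hρ

lemma tendsto_support : Tendsto (fun k => support (ρ k)) atTop (𝓝 0).smallSets :=
  hρ.tendsto_tsupport.smallSets_mono (Eventually.of_forall fun _ => subset_closure)

lemma eventually_tsupport_comp_sub_subset {K Ω : Set E} (hK : IsCompact K) (hΩ : IsOpen Ω)
    (hKΩ : K ⊆ Ω) : ∀ᶠ k in atTop, ∀ x ∈ K, tsupport (fun y => ρ k (x - y)) ⊆ Ω := by
  obtain ⟨δ, hδ, hδΩ⟩ := hK.exists_cthickening_subset_open hΩ hKΩ
  filter_upwards [hρ.tendsto_tsupport.eventually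
    (eventually_smallSets.2 ⟨_, Metric.closedBall_mem_nhds 0 hδ, fun _ h => h⟩)] with k hk x hx y hy
  have hxy : x - y ∈ tsupport (ρ k) :=
    tsupport_comp_subset_preimage (ρ k) (continuous_const.sub continuous_id) hy
  refine hδΩ (Metric.mem_cthickening_of_dist_le y x δ K hx ?_)
  rw [dist_comm, dist_eq_norm]
  exact mem_closedBall_zero_iff.1 (hk hxy)

end IsMollifierSequence

end Mollifiers

section Existence

variable {E : Type*} [NormedAddCommGroup E] [NormedSpace ℝ E] [FiniteDimensional ℝ E]
  [MeasureSpace E] [BorelSpace E] [(volume : Measure E).IsAddHaarMeasure]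

omit [FiniteDimensional ℝ E] in
lemma integrable_norm_fderiv_mul_norm {ρ : E → ℝ} (hρ : ContDiff ℝ 1 ρ)
    (hc : HasCompactSupport ρ) : Integrable fun z => ‖fderiv ℝ ρ z‖ * ‖z‖ :=
  ((hρ.continuous_fderiv one_ne_zero).norm.mul continuous_norm).integrable_of_hasCompactSupport
    (hc.fderiv ℝ).norm.mul_right

lemma lintegral_enorm_fderiv_dilate {ρ : E → ℝ} (hρ : ContDiff ℝ 1 ρ) (hc : HasCompactSupport ρ)
    {ε : ℝ} (hε : 0 < ε) :
    ∫⁻ z, ‖fderiv ℝ (dilate ε ρ) z‖ₑ * ‖z‖ₑ = ENNReal.ofReal (∫ z, ‖fderiv ℝ ρ z‖ * ‖z‖) := by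
  have hcε : HasCompactSupport (dilate ε ρ) :=
    (hc.comp_homeomorph (Homeomorph.smulOfNeZero ε⁻¹ (inv_ne_zero hε.ne'))).mul_left
  rw [← integral_dilate hε, ← funext (norm_fderiv_dilate_mul_norm hε hρ),
    ofReal_integral_eq_lintegral_ofReal
      (integrable_norm_fderiv_mul_norm (contDiff_dilate hρ ε) hcε)
      (Eventually.of_forall fun z => by positivity)]
  exact lintegral_congr fun z => by
    rw [ENNReal.ofReal_mul (norm_nonneg _), ofReal_norm, ofReal_norm]

lemma exists_isMollifierSequence : ∃ ρ : ℕ → E → ℝ, IsMollifierSequence ρ := by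
  let b : ContDiffBump (0 : E) := ⟨1 / 2, 1, by norm_num, by norm_num⟩
  let ε : ℕ → ℝ := fun k => 1 / (k + 1)
  have hε k : 0 < ε k := by positivity
  have hb : ContDiff ℝ 1 (b.normed volume) := b.contDiff_normed
  have hbt : tsupport (b.normed volume) ⊆ Metric.closedBall 0 1 := b.tsupport_normed_eq.subset
  have hts k : tsupport (dilate (ε k) (b.normed volume)) ⊆ Metric.closedBall 0 (ε k) := by
    simpa using tsupport_dilate_subset (hε k) hbt
  refine ⟨fun k => dilate (ε k) (b.normed volume), fun k => ⟨contDiff_dilate hb _,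
    (isCompact_closedBall 0 (ε k)).of_isClosed_subset (isClosed_tsupport _) (hts k), fun z =>
    mul_nonneg (by positivity) (b.nonneg_normed _), ?_⟩, ?_, ?_⟩
  · rw [integral_dilate (hε k), b.integral_normed]
  · refine tendsto_smallSets_iff.2 fun s hs => ?_
    obtain ⟨δ, hδ, hδs⟩ := Metric.nhds_basis_closedBall.mem_iff.1 hs
    filter_upwards [tendsto_one_div_add_atTop_nhds_zero_nat.eventually_le_const hδ] with k hk
    exact (hts k).trans ((Metric.closedBall_subset_closedBall hk).trans hδs)
  · exact ⟨_, fun k => (lintegral_enorm_fderiv_dilate hb b.hasCompactSupport_normed (hε k)).le⟩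

end Existence

section Friedrichs

variable {E : Type*} [NormedAddCommGroup E] [NormedSpace ℝ E] [MeasureSpace E]

/-- The mollification `x ↦ ∫ ρ (x - y) dD(y)` of a signed measure. -/
def mollifyMeasure (D : SignedMeasure E) (ρ : E → ℝ) (x : E) : ℝ :=
  ∫ᵛ y, ρ (x - y) ∂•D

/-- The kernel of Friedrichs' commutator between convolution with `ρ` and differentiation along
`X`. -/
def commKernel (X : E → E) (ρ : E → ℝ) (x y : E) : ℝ :=
  ρ (x - y) * divergence X y - fderiv ℝ ρ (x - y) (X y - X x)

variable {X : E → E} {ρ : E → ℝ}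

omit [MeasureSpace E] in
lemma enorm_commKernel_le {M L : ℝ≥0} (hM : ∀ y, ‖divergence X y‖ ≤ M) (hL : LipschitzWith L X)
    (x y : E) : ‖commKernel X ρ x y‖ₑ ≤
      M * ‖ρ (x - y)‖ₑ + L * (‖fderiv ℝ ρ (x - y)‖ₑ * ‖x - y‖ₑ) := by
  have hMy : ‖divergence X y‖ₑ ≤ M := enorm_le_coe.2 (hM y)
  have hLxy : ‖X y - X x‖ₑ ≤ L * ‖x - y‖ₑ := by
    rw [← edist_eq_enorm_sub, ← edist_eq_enorm_sub, edist_comm x]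
    exact hL y x
  calc ‖commKernel X ρ x y‖ₑ
      ≤ ‖ρ (x - y) * divergence X y‖ₑ + ‖fderiv ℝ ρ (x - y) (X y - X x)‖ₑ := enorm_sub_le
    _ ≤ ‖ρ (x - y)‖ₑ * M + ‖fderiv ℝ ρ (x - y)‖ₑ * (L * ‖x - y‖ₑ) := by
        rw [enorm_mul]
        gcongr
        exact ((fderiv ℝ ρ (x - y)).le_opENorm _).trans (by gcongr)
    _ = M * ‖ρ (x - y)‖ₑ + L * (‖fderiv ℝ ρ (x - y)‖ₑ * ‖x - y‖ₑ) := by ring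

omit [NormedSpace ℝ E] [MeasureSpace E] in
lemma hasCompactSupport_comp_sub_left (hc : HasCompactSupport ρ) (x : E) :
    HasCompactSupport fun y => ρ (x - y) :=
  hc.comp_homeomorph (Homeomorph.subLeft x)

variable [FiniteDimensional ℝ E]

omit [MeasureSpace E] in
lemma divergence_comp_sub_smul (hρ : ContDiff ℝ 1 ρ) {V : E → E} (hV : ContDiff ℝ 1 V) (x y : E) :
    divergence (fun y => ρ (x - y) • V y) y =
      ρ (x - y) * divergence V y - fderiv ℝ ρ (x - y) (V y) := by
  have h : HasFDerivAt (fun y => ρ (x - y)) (-fderiv ℝ ρ (x - y)) y := by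
    simpa [Function.comp_def] using ((hρ.differentiable one_ne_zero (x - y)).hasFDerivAt).comp y
      ((hasFDerivAt_id y).const_sub x)
  rw [divergence_smul h.differentiableAt (hV.differentiable one_ne_zero y), h.fderiv,
    neg_apply, ← sub_eq_add_neg]

omit [MeasureSpace E] in
lemma commKernel_eq_divergence (hρ : ContDiff ℝ 1 ρ) (hX : ContDiff ℝ 1 X) (x y : E) :
    commKernel X ρ x y = divergence (fun y => ρ (x - y) • (X y - X x)) y := by
  rw [divergence_comp_sub_smul hρ (hX.sub contDiff_const),
    divergence_sub (hX.differentiable one_ne_zero y) (differentiableAt_const _), divergence_const,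
    sub_zero, commKernel]

omit [MeasureSpace E] in
lemma commKernel_eq_add_divergence (hρ : ContDiff ℝ 1 ρ) (hX : ContDiff ℝ 1 X) (x y : E) :
    commKernel X ρ x y =
      fderiv ℝ ρ (x - y) (X x) + divergence (fun y => ρ (x - y) • X y) y := by
  rw [divergence_comp_sub_smul hρ hX, commKernel, map_sub]
  ring

variable [BorelSpace E] [(volume : Measure E).IsAddHaarMeasure] {u : E → ℝ}

omit [NormedSpace ℝ E] [FiniteDimensional ℝ E] [(volume : Measure E).IsAddHaarMeasure] in
lemma integrable_mul_of_hasCompactSupport (hu : Integrable u) {g : E → ℝ} (hg : Continuous g)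
    (hc : HasCompactSupport g) : Integrable fun y => u y * g y := by
  obtain ⟨C, hC⟩ := hg.bounded_above_of_compact_support hc
  exact hu.mul_bdd hg.aestronglyMeasurable (Eventually.of_forall hC)

-- The commutator kernel is a divergence in `y`, so it has mean zero and `u x` may be subtracted.
lemma integral_sub_mul_commKernel (hρ : ContDiff ℝ 1 ρ) (hc : HasCompactSupport ρ)
    (hX : ContDiff ℝ 1 X) (hu : Integrable u) (x : E) :
    ∫ y, (u y - u x) * commKernel X ρ x y = ∫ y, u y * commKernel X ρ x y := by
  have hV : ContDiff ℝ 1 fun y => ρ (x - y) • (X y - X x) := by fun_prop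
  have hVc : HasCompactSupport fun y => ρ (x - y) • (X y - X x) :=
    (hasCompactSupport_comp_sub_left hc x).smul_right
  simp_rw [commKernel_eq_divergence hρ hX, sub_mul]
  have hdiv := continuous_divergence hV
  have hdivc := hasCompactSupport_divergence hVc
  rw [integral_sub (integrable_mul_of_hasCompactSupport hu hdiv hdivc)
    ((hdiv.integrable_of_hasCompactSupport hdivc).const_mul _), integral_const_mul,
    integral_divergence_eq_zero volume hV hVc, mul_zero, sub_zero]

lemma fderiv_convolution_apply (hρ : ContDiff ℝ 1 ρ) (hc : HasCompactSupport ρ)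
    (hu : Integrable u) (x v : E) :
    fderiv ℝ (u ⋆ ρ) x v = ∫ y, u y * fderiv ℝ ρ (x - y) v := by
  rw [(hc.hasFDerivAt_convolution_right _ hu.locallyIntegrable hρ x).fderiv,
    convolution_precompR_apply _ hu.locallyIntegrable (hc.fderiv ℝ)
      (hρ.continuous_fderiv one_ne_zero)]
  rfl

lemma fderiv_convolution_sub_mollifyMeasure (hρ : ContDiff ℝ 1 ρ) (hc : HasCompactSupport ρ)
    (hX : ContDiff ℝ 1 X) (hu : Integrable u) {Ω : Set E} (hu0 : ∀ x ∉ Ω, u x = 0)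
    {D : SignedMeasure E} (hD : HasWeakDeriv X Ω u D) {x : E}
    (hx : tsupport (fun y => ρ (x - y)) ⊆ Ω) :
    fderiv ℝ (u ⋆ ρ) x (X x) - mollifyMeasure D ρ x =
      ∫ y, (u y - u x) * commKernel X ρ x y := by
  have hψ : ContDiff ℝ 1 fun y => ρ (x - y) := by fun_prop
  have hψc := hasCompactSupport_comp_sub_left hc x
  have hDψ : mollifyMeasure D ρ x = -∫ y, u y * divergence (fun y => ρ (x - y) • X y) y := by
    rw [mollifyMeasure, hD _ hψ hψc hx,
      setIntegral_eq_integral_of_forall_compl_eq_zero fun y hy => by rw [hu0 y hy, zero_mul]]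
  have hfd : Continuous fun y => fderiv ℝ ρ (x - y) (X x) := by
    have := hρ.continuous_fderiv one_ne_zero
    fun_prop
  rw [integral_sub_mul_commKernel hρ hc hX hu, fderiv_convolution_apply hρ hc hu, hDψ,
    sub_neg_eq_add, ← integral_add
      (integrable_mul_of_hasCompactSupport hu hfd
        (hasCompactSupport_comp_sub_left (hc.fderiv_apply ℝ (X x)) x))
      (integrable_mul_of_hasCompactSupport hu (continuous_divergence_smul hψ hX)
        (hasCompactSupport_divergence_smul hψc X))]
  simp_rw [commKernel_eq_add_divergence hρ hX, mul_add]

end Friedrichs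

section MollifierLimits

variable {E : Type*} [NormedAddCommGroup E] [NormedSpace ℝ E] [FiniteDimensional ℝ E]
  [MeasureSpace E] [BorelSpace E] [(volume : Measure E).IsAddHaarMeasure] {u : E → ℝ}

namespace IsMollifier

variable {ρ : E → ℝ} (hρ : IsMollifier ρ)
include hρ

omit [FiniteDimensional ℝ E] in
lemma integrable : Integrable ρ :=
  hρ.contDiff.continuous.integrable_of_hasCompactSupport hρ.hasCompactSupport

omit [FiniteDimensional ℝ E] in
lemma lintegral_enorm_eq_one : ∫⁻ z, ‖ρ z‖ₑ = 1 := by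
  rw [← ofReal_integral_norm_eq_lintegral_enorm hρ.integrable]
  simp_rw [Real.norm_of_nonneg (hρ.nonneg _)]
  rw [hρ.integral_eq_one, ENNReal.ofReal_one]

omit [FiniteDimensional ℝ E] [(volume : Measure E).IsAddHaarMeasure] in
lemma contDiff_convolution (hu : Integrable u) : ContDiff ℝ 1 (u ⋆ ρ) :=
  hρ.hasCompactSupport.contDiff_convolution_right (n := 1) _ hu.locallyIntegrable hρ.contDiff

lemma integrable_convolution (hu : Integrable u) : Integrable (u ⋆ ρ) :=
  hu.integrable_convolution _ hρ.integrable

lemma convolution_sub_eq_integral (hu : Integrable u) (x : E) :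
    (u ⋆ ρ) x - u x = ∫ y, (u y - u x) * ρ (x - y) := by
  have hint : Integrable fun y => u y * ρ (x - y) :=
    hρ.hasCompactSupport.convolutionExists_right (ContinuousLinearMap.mul ℝ ℝ)
      hu.locallyIntegrable hρ.contDiff.continuous x
  simp_rw [sub_mul]
  rw [integral_sub hint ((hρ.integrable.comp_sub_left x).const_mul _), integral_const_mul,
    integral_sub_left_eq_self, hρ.integral_eq_one, mul_one]
  rfl

end IsMollifier

namespace IsMollifierSequence

variable {ρ : ℕ → E → ℝ} (hρ : IsMollifierSequence ρ)
include hρ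

lemma tendsto_integral_abs_convolution_sub (hum : Measurable u) (hu : Integrable u) :
    Tendsto (fun k => ∫ x, |(u ⋆ ρ k) x - u x|) atTop (𝓝 0) := by
  have h := tendsto_lintegral_enorm_kernel_integral hum hu (q := fun k x y => ρ k (x - y))
    (fun k => (hρ.isMollifier k).contDiff.continuous.measurable.enorm) ENNReal.one_ne_top
    (fun k => (hρ.isMollifier k).lintegral_enorm_eq_one.le)
    (by simpa [support, enorm_eq_zero] using hρ.tendsto_support) (fun _ _ _ => le_rfl)
  simp_rw [← fun k => (hρ.isMollifier k).convolution_sub_eq_integral hu] at h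
  have h' := (ENNReal.tendsto_toReal ENNReal.zero_ne_top).comp h
  refine h'.congr fun k => (integral_norm_eq_lintegral_enorm ?_).symm
  exact (((hρ.isMollifier k).integrable_convolution hu).sub hu).aestronglyMeasurable

lemma tendsto_lintegral_enorm_commKernel_integral (hum : Measurable u) (hu : Integrable u)
    {X : E → E} (hX : ContDiff ℝ 1 X) (hXc : HasCompactSupport X) :
    Tendsto (fun k => ∫⁻ x, ‖∫ y, (u y - u x) * commKernel X (ρ k) x y‖ₑ) atTop (𝓝 0) := by
  obtain ⟨L, hL⟩ := hX.lipschitzWith_of_hasCompactSupport hXc one_ne_zero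
  obtain ⟨M, hM⟩ := (continuous_divergence hX).bounded_above_of_compact_support
    (hasCompactSupport_divergence hXc)
  obtain ⟨C, hC⟩ := hρ.exists_fderiv_bound
  have hρm k : Measurable fun z => ‖ρ k z‖ₑ :=
    (hρ.isMollifier k).contDiff.continuous.measurable.enorm
  have hdm k : Measurable fun z => ‖fderiv ℝ (ρ k) z‖ₑ * ‖z‖ₑ :=
    ((hρ.isMollifier k).contDiff.continuous_fderiv one_ne_zero).measurable.enorm.mul
      measurable_enorm
  lift M to ℝ≥0 using (norm_nonneg _).trans (hM 0)
  refine tendsto_lintegral_enorm_kernel_integral hum hu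
    (κ := fun k z => M * ‖ρ k z‖ₑ + L * (‖fderiv ℝ (ρ k) z‖ₑ * ‖z‖ₑ))
    (fun k => ((hρm k).const_mul _).add ((hdm k).const_mul _)) (C := M * 1 + L * C)
    (by finiteness) (fun k => ?_) ?_ fun k => enorm_commKernel_le hM hL
  · rw [lintegral_add_left ((hρm k).const_mul _), lintegral_const_mul _ (hρm k),
      lintegral_const_mul _ (hdm k), (hρ.isMollifier k).lintegral_enorm_eq_one]
    gcongr
    exact hC k
  · refine hρ.tendsto_tsupport.smallSets_mono (Eventually.of_forall fun k => ?_)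
    refine fun z => not_imp_not.1 fun hz => notMem_support.2 ?_
    have h₁ : ‖ρ k z‖ₑ = 0 := enorm_eq_zero.2 (image_eq_zero_of_notMem_tsupport hz)
    have hz' : z ∉ support (fderiv ℝ (ρ k)) := fun h => hz (support_fderiv_subset ℝ h)
    have h₂ : ‖fderiv ℝ (ρ k) z‖ₑ = 0 := by
      simp [enorm_eq_nnnorm, notMem_support.1 hz']
    simp only [h₁, h₂, zero_mul, mul_zero, add_zero]

lemma tendsto_setLIntegral_commutator (hum : Measurable u) (hu : Integrable u)
    {X : E → E} (hX : ContDiff ℝ 1 X) (hXc : HasCompactSupport X) {Ω : Set E} (hΩ : IsOpen Ω)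
    (hu0 : ∀ x ∉ Ω, u x = 0) {D : SignedMeasure E} (hD : HasWeakDeriv X Ω u D) {K : Set E}
    (hK : IsCompact K) (hKΩ : K ⊆ Ω) :
    Tendsto (fun k => ∫⁻ x in K, ‖fderiv ℝ (u ⋆ ρ k) x (X x) - mollifyMeasure D (ρ k) x‖ₑ) atTop
      (𝓝 0) := by
  refine tendsto_of_tendsto_of_tendsto_of_le_of_le' tendsto_const_nhds
    (hρ.tendsto_lintegral_enorm_commKernel_integral hum hu hX hXc)
    (Eventually.of_forall fun _ => zero_le) ?_
  filter_upwards [hρ.eventually_tsupport_comp_sub_subset hK hΩ hKΩ] with k hk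
  calc ∫⁻ x in K, ‖fderiv ℝ (u ⋆ ρ k) x (X x) - mollifyMeasure D (ρ k) x‖ₑ
      = ∫⁻ x in K, ‖∫ y, (u y - u x) * commKernel X (ρ k) x y‖ₑ :=
        setLIntegral_congr_fun hK.measurableSet fun x hx => by
          rw [fderiv_convolution_sub_mollifyMeasure (hρ.isMollifier k).contDiff
            (hρ.isMollifier k).hasCompactSupport hX hu hu0 hD (hk x hx)]
    _ ≤ ∫⁻ x, ‖∫ y, (u y - u x) * commKernel X (ρ k) x y‖ₑ := setLIntegral_le_lintegral _ _

end IsMollifierSequence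

end MollifierLimits

section VagueLimit

open scoped CompactlySupported

variable {T : Type*} [TopologicalSpace T] [MeasurableSpace T]

-- Limits are taken along the ultrafilter `hyperfilter ℕ`, so that no subsequence is extracted and
-- one limit serves all test functions.
lemma exists_tendsto_integral_hyperfilter {ν : ℕ → Measure T} {M : ℝ≥0} (hM : ∀ k, ν k univ ≤ M)
    (f : C_c(T, ℝ)) : ∃ a, Tendsto (fun k => ∫ x, f x ∂ν k) (hyperfilter ℕ) (𝓝 a) := by
  obtain ⟨C, hC⟩ := f.continuous.bounded_above_of_compact_support f.hasCompactSupport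
  have hbound k : |∫ x, f x ∂ν k| ≤ max C 0 * M := by
    have : IsFiniteMeasure (ν k) := ⟨(hM k).trans_lt ENNReal.coe_lt_top⟩
    calc |∫ x, f x ∂ν k| ≤ max C 0 * (ν k).real univ := norm_integral_le_of_norm_le_const
          (Eventually.of_forall fun x => (hC x).trans (le_max_left _ _))
      _ ≤ max C 0 * M := by
          gcongr
          exact ENNReal.toReal_le_coe_of_le_coe (hM k)
  obtain ⟨a, -, ha⟩ := (isCompact_Icc (a := -(max C 0 * M)) (b := max C 0 * M)).ultrafilter_le_nhds'
    ((hyperfilter ℕ).map fun k => ∫ x, f x ∂ν k)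
    (Ultrafilter.mem_map.2 (univ_mem' fun k => abs_le.1 (hbound k)))
  exact ⟨a, ha⟩

variable [BorelSpace T] [T2Space T] [LocallyCompactSpace T] [SigmaCompactSpace T]

lemma rieszMeasure_univ_le (Λ : C_c(T, ℝ) →ₚ[ℝ] ℝ) {M : ℝ≥0}
    (hΛ : ∀ f : C_c(T, ℝ), (∀ x, f x ∈ Icc 0 1) → Λ f ≤ M) :
    RealRMK.rieszMeasure Λ univ ≤ M := by
  rw [← iUnion_compactCovering T,
    (monotone_nat_of_le_succ (compactCovering_subset T ·.le_succ)).measure_iUnion]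
  refine iSup_le fun j => ?_
  obtain ⟨f, hf1, -, hfc, hf01⟩ := exists_continuous_one_zero_of_isCompact
    (isCompact_compactCovering T j) isClosed_empty (disjoint_empty _)
  refine (RealRMK.rieszMeasure_le_of_eq_one Λ (f := ⟨f, hfc⟩) (fun x => (hf01 x).1)
    (isCompact_compactCovering T j) hf1).trans ?_
  exact (ENNReal.ofReal_le_ofReal (hΛ _ hf01)).trans_eq (ENNReal.ofReal_coe_nnreal)

lemma exists_measure_tendsto_integral_hyperfilter {ν : ℕ → Measure T} {M : ℝ≥0}
    (hM : ∀ k, ν k univ ≤ M) :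
    ∃ ν' : Measure T, IsFiniteMeasure ν' ∧ ∀ f : T → ℝ, Continuous f → HasCompactSupport f →
      Tendsto (fun k => ∫ x, f x ∂ν k) (hyperfilter ℕ) (𝓝 (∫ x, f x ∂ν')) := by
  have hfin k : IsFiniteMeasure (ν k) := ⟨(hM k).trans_lt ENNReal.coe_lt_top⟩
  have hint (f : C_c(T, ℝ)) k : Integrable f (ν k) :=
    f.continuous.integrable_of_hasCompactSupport f.hasCompactSupport
  choose a ha using exists_tendsto_integral_hyperfilter hM
  let Λ₀ : C_c(T, ℝ) →ₗ[ℝ] ℝ :=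
    { toFun := a
      map_add' f g := tendsto_nhds_unique (ha (f + g)) <|
        ((ha f).add (ha g)).congr fun k => (integral_add (hint f k) (hint g k)).symm
      map_smul' c f := tendsto_nhds_unique (ha (c • f)) <|
        ((ha f).const_mul c).congr fun k => (integral_const_mul c f).symm }
  let Λ : C_c(T, ℝ) →ₚ[ℝ] ℝ := PositiveLinearMap.mk₀ Λ₀ fun f hf =>
    ge_of_tendsto' (ha f) fun k => integral_nonneg hf
  have hΛ (f : C_c(T, ℝ)) (hf : ∀ x, f x ∈ Icc 0 1) : Λ f ≤ M :=
    le_of_tendsto' (ha f) fun k => calc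
      ∫ x, f x ∂ν k ≤ ∫ _, 1 ∂ν k := integral_mono (hint f k) (integrable_const _) fun x => (hf x).2
      _ ≤ M := by simpa using! ENNReal.toReal_le_coe_of_le_coe (hM k)
  refine ⟨RealRMK.rieszMeasure Λ, ⟨(rieszMeasure_univ_le Λ hΛ).trans_lt ENNReal.coe_lt_top⟩,
    fun f hf hfc => ?_⟩
  have h : ∫ x, f x ∂(RealRMK.rieszMeasure Λ) = a ⟨⟨f, hf⟩, hfc⟩ :=
    RealRMK.integral_rieszMeasure Λ ⟨⟨f, hf⟩, hfc⟩
  rw [h]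
  exact ha ⟨⟨f, hf⟩, hfc⟩

end VagueLimit

section MollifiedMeasures

variable {E : Type*} [NormedAddCommGroup E] [MeasureSpace E]

/-- The measure with density `ρ` with respect to `volume`; the mollification of a measure `μ` by `ρ`
is the convolution `μ ∗ densityMeasure ρ`. -/
def densityMeasure (ρ : E → ℝ) : Measure E :=
  volume.withDensity fun z => ENNReal.ofReal (ρ z)

variable [NormedSpace ℝ E] [FiniteDimensional ℝ E] [BorelSpace E]

lemma conv_apply_univ (μ ν : Measure E) [SFinite μ] [SFinite ν] :
    (μ ∗ ν) univ = μ univ * ν univ := by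
  rw [Measure.conv, Measure.map_apply (by fun_prop) .univ, preimage_univ, ← univ_prod_univ,
    Measure.prod_prod]

namespace IsMollifier

variable {ρ : E → ℝ} (hρ : IsMollifier ρ) (μ : Measure E) [IsFiniteMeasure μ]
include hρ

lemma integrable_comp_sub (x : E) : Integrable (fun y => ρ (x - y)) μ := by
  have := hρ.contDiff.continuous
  exact (by fun_prop : Continuous fun y => ρ (x - y)).integrable_of_hasCompactSupport
    (hasCompactSupport_comp_sub_left hρ.hasCompactSupport x)

lemma toReal_lintegral_comp_sub (x : E) :
    (∫⁻ y, ENNReal.ofReal (ρ (x - y)) ∂μ).toReal = ∫ y, ρ (x - y) ∂μ :=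
  (integral_eq_lintegral_of_nonneg_ae (Eventually.of_forall fun _ => hρ.nonneg _)
    (hρ.integrable_comp_sub μ x).aestronglyMeasurable).symm

lemma measurable_lintegral_comp_sub :
    Measurable fun x => ∫⁻ y, ENNReal.ofReal (ρ (x - y)) ∂μ := by
  have := hρ.contDiff.continuous.measurable
  have hm : Measurable fun p : E × E => ENNReal.ofReal (ρ (p.1 - p.2)) := by fun_prop
  exact hm.lintegral_prod_right

lemma lintegral_comp_sub_lt_top (x : E) : ∫⁻ y, ENNReal.ofReal (ρ (x - y)) ∂μ < ⊤ :=
  (hρ.integrable_comp_sub μ x).lintegral_lt_top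

lemma mollifyMeasure_eq_sub (D : SignedMeasure E) (x : E) :
    mollifyMeasure D ρ x = ∫ y, ρ (x - y) ∂D.toJordanDecomposition.posPart
      - ∫ y, ρ (x - y) ∂D.toJordanDecomposition.negPart :=
  integral_signed_eq_sub D (hρ.integrable_comp_sub _ x)

lemma sum_mul_mollifyMeasure_le {κ : Type*} [Fintype κ] (D : κ → SignedMeasure E)
    (v : EuclideanSpace ℝ κ) (x : E) :
    ∑ i, v i * mollifyMeasure (D i) ρ x ≤ ‖v‖ * ∫ y, ρ (x - y) ∂totalVar D := by
  have hint : Integrable (fun y => ρ (x - y) • v) (totalVar D) :=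
    (hρ.integrable_comp_sub _ x).smul_const v
  calc ∑ i, v i * mollifyMeasure (D i) ρ x
      = ∑ i, ∫ᵛ y, (ρ (x - y) • v) i ∂•D i := by
        refine Finset.sum_congr rfl fun i _ => ?_
        simp_rw [mollifyMeasure, PiLp.smul_apply, smul_eq_mul, mul_comm _ (v i)]
        exact (VectorMeasure.integral_fun_smul (D i) _ (v i) fun y => ρ (x - y)).symm
    _ ≤ ∫ y, ‖ρ (x - y) • v‖ ∂totalVar D := (le_abs_self _).trans (abs_sum_integral_le D hint)
    _ = ‖v‖ * ∫ y, ρ (x - y) ∂totalVar D := by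
        simp_rw [norm_smul, Real.norm_of_nonneg (hρ.nonneg _)]
        rw [integral_mul_const, mul_comm]

end IsMollifier

variable [(volume : Measure E).IsAddHaarMeasure]

lemma conv_densityMeasure {ρ : E → ℝ} (hρ : Measurable ρ) (μ : Measure E) [SFinite μ] :
    μ ∗ densityMeasure ρ = volume.withDensity fun x => ∫⁻ y, ENNReal.ofReal (ρ (x - y)) ∂μ := by
  have hm : Measurable fun p : E × E => ENNReal.ofReal (ρ (p.1 - p.2)) := by fun_prop
  refine Measure.ext_of_lintegral _ fun f hf => ?_
  calc ∫⁻ x, f x ∂(μ ∗ densityMeasure ρ)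
      = ∫⁻ y, (∫⁻ z, ENNReal.ofReal (ρ (y + z - y)) * f (y + z)) ∂μ := by
        unfold densityMeasure
        rw [Measure.lintegral_conv hf]
        refine lintegral_congr fun y => ?_
        rw [lintegral_withDensity_eq_lintegral_mul _ (by fun_prop) (by fun_prop)]
        simp
    _ = ∫⁻ y, (∫⁻ x, ENNReal.ofReal (ρ (x - y)) * f x) ∂μ := by
        exact lintegral_congr fun y =>
          lintegral_add_left_eq_self (fun x => ENNReal.ofReal (ρ (x - y)) * f x) y
    _ = ∫⁻ x, (∫⁻ y, ENNReal.ofReal (ρ (x - y)) ∂μ) * f x := by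
        rw [lintegral_lintegral_swap (by fun_prop)]
        exact lintegral_congr fun x => lintegral_mul_const _ (hm.comp measurable_prodMk_left)
    _ = ∫⁻ x, f x ∂(volume.withDensity fun x => ∫⁻ y, ENNReal.ofReal (ρ (x - y)) ∂μ) :=
        (lintegral_withDensity_eq_lintegral_mul _ hm.lintegral_prod_right hf).symm

namespace IsMollifier

variable {ρ : E → ℝ} (hρ : IsMollifier ρ)
include hρ

omit [FiniteDimensional ℝ E] in
lemma isProbabilityMeasure_densityMeasure : IsProbabilityMeasure (densityMeasure ρ) where
  measure_univ := by
    rw [densityMeasure, withDensity_apply _ .univ, Measure.restrict_univ,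
      ← ofReal_integral_eq_lintegral_ofReal hρ.integrable (Eventually.of_forall hρ.nonneg),
      hρ.integral_eq_one, ENNReal.ofReal_one]

lemma conv_densityMeasure_univ (μ : Measure E) [SFinite μ] :
    (μ ∗ densityMeasure ρ) univ = μ univ := by
  have := hρ.isProbabilityMeasure_densityMeasure
  rw [conv_apply_univ, measure_univ (μ := densityMeasure ρ), mul_one]

variable (μ : Measure E) [IsFiniteMeasure μ]

lemma integral_conv_densityMeasure (g : E → ℝ) :
    ∫ x, g x ∂(μ ∗ densityMeasure ρ) = ∫ x, g x * ∫ y, ρ (x - y) ∂μ := by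
  rw [conv_densityMeasure hρ.contDiff.continuous.measurable,
    integral_withDensity_eq_integral_toReal_smul (hρ.measurable_lintegral_comp_sub μ)
      (Eventually.of_forall (hρ.lintegral_comp_sub_lt_top μ))]
  simp_rw [hρ.toReal_lintegral_comp_sub μ, smul_eq_mul, mul_comm]

lemma integrable_mul_integral_comp_sub {g : E → ℝ} (hg : Integrable g (μ ∗ densityMeasure ρ)) :
    Integrable fun x => g x * ∫ y, ρ (x - y) ∂μ := by
  rw [conv_densityMeasure hρ.contDiff.continuous.measurable,
    integrable_withDensity_iff (hρ.measurable_lintegral_comp_sub μ)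
      (Eventually.of_forall (hρ.lintegral_comp_sub_lt_top μ))] at hg
  simpa only [hρ.toReal_lintegral_comp_sub μ] using hg

variable (D : SignedMeasure E) {g : E → ℝ} {C : ℝ}

lemma integrable_mul_integral_comp_sub_of_bounded (hg : Measurable g) (hgC : ∀ x, ‖g x‖ ≤ C) :
    Integrable fun x => g x * ∫ y, ρ (x - y) ∂μ := by
  have := hρ.isProbabilityMeasure_densityMeasure
  exact hρ.integrable_mul_integral_comp_sub μ <|
    .of_bound hg.aestronglyMeasurable C (Eventually.of_forall hgC)

lemma integrable_mul_mollifyMeasure (hg : Measurable g) (hgC : ∀ x, ‖g x‖ ≤ C) :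
    Integrable fun x => g x * mollifyMeasure D ρ x := by
  simp_rw [hρ.mollifyMeasure_eq_sub D, mul_sub]
  exact (hρ.integrable_mul_integral_comp_sub_of_bounded _ hg hgC).sub
    (hρ.integrable_mul_integral_comp_sub_of_bounded _ hg hgC)

lemma integral_mul_mollifyMeasure (hg : Measurable g) (hgC : ∀ x, ‖g x‖ ≤ C) :
    ∫ x, g x * mollifyMeasure D ρ x
      = ∫ x, g x ∂(D.toJordanDecomposition.posPart ∗ densityMeasure ρ)
        - ∫ x, g x ∂(D.toJordanDecomposition.negPart ∗ densityMeasure ρ) := by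
  simp_rw [hρ.mollifyMeasure_eq_sub D, mul_sub]
  rw [integral_sub (hρ.integrable_mul_integral_comp_sub_of_bounded _ hg hgC)
      (hρ.integrable_mul_integral_comp_sub_of_bounded _ hg hgC),
    hρ.integral_conv_densityMeasure, hρ.integral_conv_densityMeasure]

lemma sum_integral_mul_mollifyMeasure_le {κ : Type*} [Fintype κ] (D : κ → SignedMeasure E)
    {F : E → EuclideanSpace ℝ κ} (hF : Measurable F) (hF1 : ∀ x, ‖F x‖ ≤ 1) :
    ∑ i, ∫ x, F x i * mollifyMeasure (D i) ρ x ≤ (totalVar D).real univ := by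
  have hFi i : Measurable fun x => F x i := by fun_prop
  have hF1i i x : ‖F x i‖ ≤ 1 := (PiLp.norm_apply_le _ i).trans (hF1 x)
  have hint i := hρ.integrable_mul_mollifyMeasure (D i) (hFi i) (hF1i i)
  rw [← integral_finsetSum _ fun i _ => hint i]
  calc ∫ x, ∑ i, F x i * mollifyMeasure (D i) ρ x
      ≤ ∫ x, 1 * ∫ y, ρ (x - y) ∂totalVar D := by
        refine integral_mono (integrable_finsetSum _ fun i _ => hint i)
          (hρ.integrable_mul_integral_comp_sub_of_bounded (C := 1) _ measurable_const (by simp))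
          fun x => (hρ.sum_mul_mollifyMeasure_le D (F x) x).trans ?_
        exact mul_le_mul_of_nonneg_right (hF1 x) (integral_nonneg fun y => hρ.nonneg _)
    _ = ∫ _, 1 ∂(totalVar D ∗ densityMeasure ρ) :=
        (hρ.integral_conv_densityMeasure _ _).symm
    _ = (totalVar D).real univ := by
        rw [integral_const, smul_eq_mul, mul_one, measureReal_def, hρ.conv_densityMeasure_univ,
          measureReal_def]

end IsMollifier

end MollifiedMeasures

section GraphLimit

variable {E : Type*} [NormedAddCommGroup E] [NormedSpace ℝ E] [FiniteDimensional ℝ E]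
  [MeasureSpace E] [BorelSpace E] [(volume : Measure E).IsAddHaarMeasure]
  {ρ : ℕ → E → ℝ} {w : ℕ → E → ℝ}

lemma exists_measure_tendsto_integral_conv_graph (hρ : ∀ k, IsMollifier (ρ k))
    (hw : ∀ k, Measurable (w k)) (μ : Measure E) [IsFiniteMeasure μ] :
    ∃ ν : Measure (E × ℝ), IsFiniteMeasure ν ∧ ∀ f : E × ℝ → ℝ, Continuous f →
      HasCompactSupport f → Tendsto (fun k => ∫ x, f (x, w k x) ∂(μ ∗ densityMeasure (ρ k)))
        (hyperfilter ℕ) (𝓝 (∫ p, f p ∂ν)) := by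
  have hgraph k : Measurable fun x => (x, w k x) := measurable_id.prodMk (hw k)
  obtain ⟨ν, hν, h⟩ := exists_measure_tendsto_integral_hyperfilter
    (ν := fun k => (μ ∗ densityMeasure (ρ k)).map fun x => (x, w k x)) (M := (μ univ).toNNReal)
    fun k => by
      rw [Measure.map_apply (hgraph k) .univ, preimage_univ, (hρ k).conv_densityMeasure_univ,
        ENNReal.coe_toNNReal (measure_ne_top μ univ)]
  refine ⟨ν, hν, fun f hf hfc => (h f hf hfc).congr fun k => ?_⟩
  exact integral_map (hgraph k).aemeasurable hf.aestronglyMeasurable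

lemma exists_signedMeasure_tendsto_integral_graph (hρ : ∀ k, IsMollifier (ρ k))
    (hw : ∀ k, Measurable (w k)) (D : SignedMeasure E) :
    ∃ μ : SignedMeasure (E × ℝ), ∀ f : E × ℝ → ℝ, Continuous f → HasCompactSupport f →
      Tendsto (fun k => ∫ x, f (x, w k x) * mollifyMeasure D (ρ k) x)
        (hyperfilter ℕ) (𝓝 (∫ᵛ p, f p ∂•μ)) := by
  obtain ⟨ν₁, _, h₁⟩ :=
    exists_measure_tendsto_integral_conv_graph hρ hw D.toJordanDecomposition.posPart
  obtain ⟨ν₂, _, h₂⟩ :=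
    exists_measure_tendsto_integral_conv_graph hρ hw D.toJordanDecomposition.negPart
  refine ⟨ν₁.toSignedMeasure - ν₂.toSignedMeasure, fun f hf hfc => ?_⟩
  obtain ⟨C, hC⟩ := hf.bounded_above_of_compact_support hfc
  have hint (ν : Measure (E × ℝ)) [IsFiniteMeasure ν] : ν.toSignedMeasure.Integrable f :=
    hf.integrable_of_hasCompactSupport hfc
  rw [VectorMeasure.integral_sub_vectorMeasure (hint ν₁) (hint ν₂),
    integral_signed_toSignedMeasure, integral_signed_toSignedMeasure]
  refine ((h₁ f hf hfc).sub (h₂ f hf hfc)).congr fun k => ?_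
  exact ((hρ k).integral_mul_mollifyMeasure D
    (hf.measurable.comp (measurable_id.prodMk (hw k))) fun x => hC _).symm

lemma totalVar_univ_le_of_tendsto_integral_graph (hρ : ∀ k, IsMollifier (ρ k))
    (hw : ∀ k, Measurable (w k)) {l : Filter ℕ} [l.NeBot] {κ : Type*} [Fintype κ]
    {U : Set (E × ℝ)} (hU : IsOpen U) {D : κ → SignedMeasure E} {μ : κ → SignedMeasure (E × ℝ)}
    (hμ : ∀ i A, MeasurableSet A → Disjoint A U → μ i A = 0)
    (h : ∀ i (φ : E × ℝ → ℝ), ContDiff ℝ 1 φ → HasCompactSupport φ → tsupport φ ⊆ U →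
      Tendsto (fun k => ∫ x, φ (x, w k x) * mollifyMeasure (D i) (ρ k) x) l
        (𝓝 (∫ᵛ p, φ p ∂•μ i))) :
    totalVar μ univ ≤ totalVar D univ := by
  suffices hle : totalVar μ univ ≤ ENNReal.ofReal ((totalVar D).real univ) by
    rwa [ofReal_measureReal] at hle
  refine totalVar_univ_le_of_forall_integral_le hU hμ fun φ hφ hc ht hφ1 => ?_
  have hlim i : Tendsto (fun k => ∫ x, φ (x, w k x) i * mollifyMeasure (D i) (ρ k) x) l
      (𝓝 (∫ᵛ p, φ p i ∂•μ i)) :=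
    h i (fun p => φ p i) (by fun_prop)
      (hc.comp_left (g := fun v : EuclideanSpace ℝ κ => v i) rfl)
      ((tsupport_comp_subset (g := fun v : EuclideanSpace ℝ κ => v i) rfl φ).trans ht)
  exact le_of_tendsto' (tendsto_finsetSum Finset.univ fun i _ => hlim i) fun k =>
    (hρ k).sum_integral_mul_mollifyMeasure_le D (F := fun x => φ (x, w k x))
      (hφ.continuous.measurable.comp (measurable_id.prodMk (hw k))) fun x => hφ1 _

end GraphLimit

lemma tendsto_integral_mul_of_tendsto_setLIntegral {α : Type*} [MeasurableSpace α] {μ : Measure α}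
    {l : Filter ℕ} {g F : ℕ → α → ℝ} {K : Set α} {C : ℝ} (hgC : ∀ k x, ‖g k x‖ ≤ C)
    (hgK : ∀ k, ∀ x ∉ K, g k x = 0)
    (hF : Tendsto (fun k => ∫⁻ x in K, ‖F k x‖ₑ ∂μ) l (𝓝 0)) :
    Tendsto (fun k => ∫ x, g k x * F k x ∂μ) l (𝓝 0) := by
  have hle k : ‖∫ x, g k x * F k x ∂μ‖ₑ ≤ ENNReal.ofReal C * ∫⁻ x in K, ‖F k x‖ₑ ∂μ := by
    rw [← setIntegral_eq_integral_of_forall_compl_eq_zero (s := K) fun x hx => by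
        rw [hgK k x hx, zero_mul],
      ← lintegral_const_mul' _ _ ENNReal.ofReal_ne_top]
    refine (enorm_integral_le_lintegral_enorm _).trans (lintegral_mono fun x => ?_)
    rw [enorm_mul, ← ofReal_norm (g k x)]
    gcongr
    exact hgC k x
  rw [tendsto_zero_iff_enorm_tendsto_zero]
  refine tendsto_of_tendsto_of_tendsto_of_le_of_le tendsto_const_nhds ?_ (fun _ => zero_le) hle
  simpa using ENNReal.Tendsto.const_mul hF (Or.inr ENNReal.ofReal_ne_top)

section IndicatorWeakDeriv

variable {E : Type*} [NormedAddCommGroup E] [NormedSpace ℝ E] [FiniteDimensional ℝ E]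
  [MeasureSpace E]

lemma hasWeakDeriv_indicator_one_iff {Y : E → E} {Ω S : Set E} (hS : MeasurableSet S)
    {μ : SignedMeasure E} :
    HasWeakDeriv Y Ω (S.indicator fun _ => 1) μ ↔
      ∀ ψ : E → ℝ, ContDiff ℝ 1 ψ → HasCompactSupport ψ → tsupport ψ ⊆ Ω →
        ∫ᵛ x, ψ x ∂•μ = -∫ x in S, divergence (fun y => ψ y • Y y) x := by
  refine forall_congr' fun ψ => forall₃_congr fun _ _ ht => ?_
  have h : ∫ x in Ω, S.indicator (fun _ => 1) x * divergence (fun y => ψ y • Y y) x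
      = ∫ x in S, divergence (fun y => ψ y • Y y) x := by
    rw [setIntegral_eq_integral_of_forall_compl_eq_zero fun x hx => by
        rw [image_eq_zero_of_notMem_tsupport fun h =>
          hx (ht (tsupport_divergence_smul_subset ψ Y h)), mul_zero],
      ← integral_indicator hS]
    congr 1 with x
    by_cases hx : x ∈ S <;> simp [hx]
  rw [h]

end IndicatorWeakDeriv

section GraphConvergence

variable {E : Type*} [NormedAddCommGroup E] [NormedSpace ℝ E] [FiniteDimensional ℝ E]
  [MeasureSpace E] [BorelSpace E] [(volume : Measure E).IsAddHaarMeasure]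
  {ρ : ℕ → E → ℝ} {v : E → ℝ} {Ω : Set E} {D : SignedMeasure E}

/-- The mollifications of `D`, carried by the graphs of the mollifications of `v`, converge in the
sense of distributions on `Ω × ℝ` to the derivative of the undergraph of `v` along `Y`. -/
def TendstoUndergraphDeriv (ρ : ℕ → E → ℝ) (v : E → ℝ) (Ω : Set E) (D : SignedMeasure E)
    (Y : E × ℝ → E × ℝ) : Prop :=
  ∀ φ : E × ℝ → ℝ, ContDiff ℝ 1 φ → HasCompactSupport φ → tsupport φ ⊆ Ω ×ˢ univ →
    Tendsto (fun k => ∫ x, φ (x, (v ⋆ ρ k) x) * mollifyMeasure D (ρ k) x) atTop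
      (𝓝 (-∫ p in undergraph v, divergence (fun q => φ q • Y q) p))

lemma IsMollifier.mollifyMeasure_neg_toSignedMeasure [IsFiniteMeasure (volume.restrict Ω)]
    {ρ : E → ℝ} (hρ : IsMollifier ρ) {x : E} (hx : tsupport (fun y => ρ (x - y)) ⊆ Ω) :
    mollifyMeasure (-(volume.restrict Ω).toSignedMeasure) ρ x = -1 := by
  rw [mollifyMeasure, VectorMeasure.integral_neg_vectorMeasure, integral_signed_toSignedMeasure,
    setIntegral_eq_integral_of_forall_compl_eq_zero fun y hy =>
      image_eq_zero_of_notMem_tsupport (f := fun y => ρ (x - y)) fun h => hy (hx h),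
    integral_sub_left_eq_self ρ volume x, hρ.integral_eq_one]

namespace IsMollifierSequence

variable (hρ : IsMollifierSequence ρ) (hvm : Measurable v) (hv : Integrable v)
include hρ hvm hv

lemma tendsto_setIntegral_undergraph_convolution {G : E × ℝ → ℝ} (hG : Continuous G)
    (hGc : HasCompactSupport G) :
    Tendsto (fun k => ∫ p in undergraph (v ⋆ ρ k), G p) atTop (𝓝 (∫ p in undergraph v, G p)) :=
  tendsto_setIntegral_undergraph hvm hv
    (fun k => ((hρ.isMollifier k).contDiff_convolution hv).continuous.measurable)
    (fun k => (hρ.isMollifier k).integrable_convolution hv)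
    (hρ.tendsto_integral_abs_convolution_sub hvm hv) hG hGc

lemma tendstoUndergraphDeriv_horizontalLift (hΩ : IsOpen Ω) (hv0 : ∀ x ∉ Ω, v x = 0) {X : E → E}
    (hX : ContDiff ℝ 1 X) (hXc : HasCompactSupport X) (hD : HasWeakDeriv X Ω v D) :
    TendstoUndergraphDeriv ρ v Ω D (horizontalLift X) := by
  intro φ hφ hc ht
  have hw k : ContDiff ℝ 1 (v ⋆ ρ k) := (hρ.isMollifier k).contDiff_convolution hv
  obtain ⟨C, hC⟩ := hφ.continuous.bounded_above_of_compact_support hc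
  have hK : IsCompact (Prod.fst '' tsupport φ) := hc.isCompact.image continuous_fst
  have hKΩ : Prod.fst '' tsupport φ ⊆ Ω := image_subset_iff.2 fun p hp => (ht hp).1
  have hφK k x (hx : x ∉ Prod.fst '' tsupport φ) : φ (x, (v ⋆ ρ k) x) = 0 :=
    image_eq_zero_of_notMem_tsupport fun h => hx (mem_image_of_mem Prod.fst h)
  have hgraph : Tendsto (fun k => ∫ x, φ (x, (v ⋆ ρ k) x) * fderiv ℝ (v ⋆ ρ k) x (X x)) atTop
      (𝓝 (-∫ p in undergraph v, divergence (fun q => φ q • horizontalLift X q) p)) := by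
    have hX' := contDiff_horizontalLift hX
    refine ((hρ.tendsto_setIntegral_undergraph_convolution hvm hv
      (continuous_divergence_smul hφ hX') (hasCompactSupport_divergence_smul hc _)).neg).congr
        fun k => ?_
    rw [setIntegral_undergraph_divergence_horizontalLift (hw k) hX hφ hc, neg_neg]
  have herr := tendsto_integral_mul_of_tendsto_setLIntegral (fun k x => hC (x, (v ⋆ ρ k) x)) hφK
    (hρ.tendsto_setLIntegral_commutator hvm hv hX hXc hΩ hv0 hD hK hKΩ)
  refine (by simpa using hgraph.sub herr : Tendsto _ _ _).congr fun k => ?_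
  have hφw : Continuous fun x => φ (x, (v ⋆ ρ k) x) :=
    hφ.continuous.comp (continuous_id.prodMk (hw k).continuous)
  have hi₁ : Integrable fun x => φ (x, (v ⋆ ρ k) x) * fderiv ℝ (v ⋆ ρ k) x (X x) := by
    have := (hw k).continuous_fderiv one_ne_zero
    have := hX.continuous
    refine Continuous.integrable_of_hasCompactSupport (by fun_prop) ?_
    exact HasCompactSupport.mul_right (.intro hK (hφK k))
  have hi₂ := (hρ.isMollifier k).integrable_mul_mollifyMeasure D hφw.measurable fun x => hC _
  simp_rw [mul_sub]
  rw [integral_sub hi₁ hi₂, sub_sub_cancel]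

lemma tendstoUndergraphDeriv_vertical (hΩ : IsOpen Ω) [IsFiniteMeasure (volume.restrict Ω)] :
    TendstoUndergraphDeriv ρ v Ω (-(volume.restrict Ω).toSignedMeasure) fun _ => (0, 1) := by
  intro φ hφ hc ht
  have hK : IsCompact (Prod.fst '' tsupport φ) := hc.isCompact.image continuous_fst
  have hKΩ : Prod.fst '' tsupport φ ⊆ Ω := image_subset_iff.2 fun p hp => (ht hp).1
  refine ((hρ.tendsto_setIntegral_undergraph_convolution hvm hv
    (continuous_divergence_smul hφ contDiff_const)
    (hasCompactSupport_divergence_smul hc _)).neg).congr' ?_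
  filter_upwards [hρ.eventually_tsupport_comp_sub_subset hK hΩ hKΩ] with k hk
  rw [setIntegral_undergraph_divergence_vertical
    ((hρ.isMollifier k).contDiff_convolution hv).continuous.measurable hφ hc, ← integral_neg]
  congr 1 with x
  by_cases hx : x ∈ Prod.fst '' tsupport φ
  · rw [(hρ.isMollifier k).mollifyMeasure_neg_toSignedMeasure (hk x hx), mul_neg_one]
  · have hφ0 : φ (x, (v ⋆ ρ k) x) = 0 :=
      image_eq_zero_of_notMem_tsupport fun h => hx (mem_image_of_mem Prod.fst h)
    rw [hφ0, neg_zero, zero_mul]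

end IsMollifierSequence

namespace TendstoUndergraphDeriv

variable {Y : E × ℝ → E × ℝ}

omit [FiniteDimensional ℝ E] [BorelSpace E] [(volume : Measure E).IsAddHaarMeasure] in
lemma congr_field {Z : E × ℝ → E × ℝ} (hYZ : EqOn Y Z (Ω ×ˢ univ))
    (h : TendstoUndergraphDeriv ρ v Ω D Y) : TendstoUndergraphDeriv ρ v Ω D Z := by
  intro φ hφ hc ht
  rw [← smul_eq_smul_of_tsupport_subset hYZ ht]
  exact h φ hφ hc ht

lemma exists_hasWeakDeriv (h : TendstoUndergraphDeriv ρ v Ω D Y) (hρ : ∀ k, IsMollifier (ρ k))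
    (hvm : Measurable v) (hv : Integrable v) (hΩ : MeasurableSet Ω) :
    ∃ μ : SignedMeasure (E × ℝ),
      (∀ A, MeasurableSet A → Disjoint A (Ω ×ˢ univ) → μ A = 0) ∧
      HasWeakDeriv Y (Ω ×ˢ univ) ((undergraph v).indicator fun _ => 1) μ := by
  obtain ⟨μ, hμ⟩ := exists_signedMeasure_tendsto_integral_graph hρ
    (fun k => ((hρ k).contDiff_convolution hv).continuous.measurable) D
  have hm : MeasurableSet (Ω ×ˢ (univ : Set ℝ)) := hΩ.prod .univ
  refine ⟨μ.restrict (Ω ×ˢ univ), fun A hA hd => ?_,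
    (hasWeakDeriv_indicator_one_iff (measurableSet_undergraph hvm)).2 fun φ hφ hc ht => ?_⟩
  · rw [VectorMeasure.restrict_apply _ hm hA, hd.inter_eq, VectorMeasure.empty]
  · rw [VectorMeasure.setIntegral_eq_integral_of_forall_compl_eq_zero hm fun p hp =>
      image_eq_zero_of_notMem_tsupport fun h' => hp (ht h')]
    exact tendsto_nhds_unique (hμ φ hφ.continuous hc)
      ((h φ hφ hc ht).mono_left Nat.hyperfilter_le_atTop)

lemma totalVar_univ_le {κ : Type*} [Fintype κ] {Y : κ → E × ℝ → E × ℝ} {D : κ → SignedMeasure E}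
    (h : ∀ i, TendstoUndergraphDeriv ρ v Ω (D i) (Y i)) (hρ : ∀ k, IsMollifier (ρ k))
    (hvm : Measurable v) (hv : Integrable v) (hΩ : IsOpen Ω) {μ : κ → SignedMeasure (E × ℝ)}
    (hμ0 : ∀ i A, MeasurableSet A → Disjoint A (Ω ×ˢ univ) → μ i A = 0)
    (hμ : ∀ i, HasWeakDeriv (Y i) (Ω ×ˢ univ) ((undergraph v).indicator fun _ => 1) (μ i)) :
    totalVar μ univ ≤ totalVar D univ := by
  refine totalVar_univ_le_of_tendsto_integral_graph hρ
    (fun k => ((hρ k).contDiff_convolution hv).continuous.measurable) (l := atTop)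
    (hΩ.prod isOpen_univ) hμ0 fun i φ hφ hc ht => ?_
  rw [(hasWeakDeriv_indicator_one_iff (measurableSet_undergraph hvm)).1 (hμ i) φ hφ hc ht]
  exact h i φ hφ hc ht

end TendstoUndergraphDeriv

end GraphConvergence

section Cutoff

/-- A sequence of smooth vertical cutoffs `η k` with values in `[0, 1]`, equal to `1` on `[-k, k]`;
multiplying by them turns test functions on `Ω` into test functions on `Ω × ℝ`. -/
structure IsCutoffSequence (η : ℕ → ℝ → ℝ) : Prop where
  contDiff : ∀ k, ContDiff ℝ ∞ (η k)
  hasCompactSupport : ∀ k, HasCompactSupport (η k)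
  mem_Icc : ∀ k t, η k t ∈ Icc (0 : ℝ) 1
  eqOn_one : ∀ k : ℕ, EqOn (η k) 1 (Icc (-k) k)

lemma exists_isCutoffSequence : ∃ η, IsCutoffSequence η := by
  have h (k : ℕ) := exists_contDiff_eq_one_on_isCompact (isCompact_Icc (a := -(k : ℝ)) (b := k))
    isOpen_univ (subset_univ _)
  choose η hη hηc _ hη01 hη1 using h
  exact ⟨η, hη, hηc, hη01, hη1⟩

lemma tsupport_mul_comp_snd_subset {E : Type*} [TopologicalSpace E] {Ω : Set E} {ψ : E → ℝ}
    (hψ : tsupport ψ ⊆ Ω) (θ : ℝ → ℝ) :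
    tsupport (fun p : E × ℝ => ψ p.1 * θ p.2) ⊆ Ω ×ˢ univ :=
  (closure_minimal (t := tsupport ψ ×ˢ univ)
    (fun _ hp => ⟨subset_tsupport _ (left_ne_zero_of_mul hp), mem_univ _⟩)
    ((isClosed_tsupport _).prod isClosed_univ)).trans (prod_mono hψ subset_rfl)

lemma hasCompactSupport_mul_comp_snd {E : Type*} [TopologicalSpace E] [R1Space E] {ψ : E → ℝ}
    {θ : ℝ → ℝ} (hψ : HasCompactSupport ψ) (hθ : HasCompactSupport θ) :
    HasCompactSupport fun p : E × ℝ => ψ p.1 * θ p.2 :=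
  .of_support_subset_isCompact (hψ.isCompact.prod hθ.isCompact) fun _ hp =>
    ⟨subset_tsupport _ (left_ne_zero_of_mul hp), subset_tsupport _ (right_ne_zero_of_mul hp)⟩

namespace IsCutoffSequence

variable {η : ℕ → ℝ → ℝ} (hη : IsCutoffSequence η)
include hη

lemma continuous (k : ℕ) : Continuous (η k) := (hη.contDiff k).continuous

lemma integrable (k : ℕ) : Integrable (η k) :=
  (hη.continuous k).integrable_of_hasCompactSupport (hη.hasCompactSupport k)

lemma norm_le_one (k : ℕ) (t : ℝ) : ‖η k t‖ ≤ 1 := by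
  rw [Real.norm_of_nonneg (hη.mem_Icc k t).1]
  exact (hη.mem_Icc k t).2

lemma eventually_eqOn_one (r : ℝ) : ∀ᶠ k in atTop, EqOn (η k) 1 (Icc (-r) r) := by
  filter_upwards [tendsto_natCast_atTop_atTop.eventually_ge_atTop r] with k hk
  exact (hη.eqOn_one k).mono (Icc_subset_Icc (neg_le_neg hk) hk)

lemma tendsto_one (t : ℝ) : Tendsto (fun k => η k t) atTop (𝓝 1) :=
  tendsto_const_nhds.congr' <| (hη.eventually_eqOn_one |t|).mono fun _ hk =>
    (hk (abs_le.1 le_rfl)).symm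

lemma tendsto_intervalIntegral (a : ℝ) : Tendsto (fun k => ∫ t in 0..a, η k t) atTop (𝓝 a) := by
  have h := intervalIntegral.tendsto_integral_filter_of_dominated_convergence (μ := volume)
    (a := 0) (b := a) (F := η) (f := 1) (l := atTop) (fun _ => 1)
    (.of_forall fun k => (hη.continuous k).aestronglyMeasurable)
    (.of_forall fun k => .of_forall fun t _ => hη.norm_le_one k t)
    intervalIntegrable_const (.of_forall fun t _ => hη.tendsto_one t)
  simpa using h

lemma norm_intervalIntegral_le (k : ℕ) (a : ℝ) : ‖∫ t in 0..a, η k t‖ ≤ |a| := by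
  simpa using intervalIntegral.norm_integral_le_of_norm_le_const (a := 0) (b := a)
    fun t _ => hη.norm_le_one k t

lemma tendsto_integral_intervalIntegral_mul {α : Type*} [MeasurableSpace α] {μ : Measure α}
    {v d : α → ℝ} (hvm : Measurable v) (hv : Integrable v μ) (hd : AEStronglyMeasurable d μ)
    {C : ℝ} (hC : ∀ x, ‖d x‖ ≤ C) :
    Tendsto (fun k => ∫ x, (∫ t in 0..v x, η k t) * d x ∂μ) atTop (𝓝 (∫ x, v x * d x ∂μ)) := by
  refine tendsto_integral_of_dominated_convergence (fun x => |v x| * C) (fun k => ?_)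
    (hv.abs.mul_const C) (fun k => .of_forall fun x => ?_)
    (.of_forall fun x => (hη.tendsto_intervalIntegral (v x)).mul_const _)
  · have hcont : Continuous fun s => ∫ t in 0..s, η k t :=
      intervalIntegral.continuous_primitive (fun _ _ => (hη.integrable k).intervalIntegrable) 0
    exact (hcont.measurable.comp hvm).aestronglyMeasurable.mul hd
  · rw [norm_mul]
    exact mul_le_mul (hη.norm_intervalIntegral_le k _) (hC x) (norm_nonneg _) (abs_nonneg _)

lemma tendsto_integral_mul_comp {α : Type*} [MeasurableSpace α] {μ : Measure α} {v g : α → ℝ}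
    (hv : Measurable v) (hg : Integrable g μ) :
    Tendsto (fun k => ∫ x, g x * η k (v x) ∂μ) atTop (𝓝 (∫ x, g x ∂μ)) := by
  refine tendsto_integral_of_dominated_convergence (fun x => ‖g x‖) (fun k => ?_) hg.norm
    (fun k => .of_forall fun x => ?_) (.of_forall fun x => ?_)
  · exact hg.aestronglyMeasurable.mul
      ((hη.continuous k).measurable.comp hv).aestronglyMeasurable
  · rw [norm_mul]
    exact mul_le_of_le_one_right (norm_nonneg _) (hη.norm_le_one k _)
  · simpa using (hη.tendsto_one (v x)).const_mul (g x)

lemma tendsto_integral_mul_comp_snd {E : Type*} [TopologicalSpace E] [SecondCountableTopology E]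
    [MeasurableSpace E] [BorelSpace E] (μ : SignedMeasure (E × ℝ)) {ψ : E → ℝ}
    (hψ : Continuous ψ) (hψc : HasCompactSupport ψ) :
    Tendsto (fun k => ∫ᵛ p, ψ p.1 * η k p.2 ∂•μ) atTop (𝓝 (∫ᵛ x, ψ x ∂•(μ.map Prod.fst))) := by
  obtain ⟨C, hC⟩ := hψ.bounded_above_of_compact_support hψc
  have hψfst : Continuous fun p : E × ℝ => ψ p.1 := by fun_prop
  rw [VectorMeasure.integral_map measurable_fst hψ.aestronglyMeasurable
    (Integrable.of_bound (μ := μ.variation) hψfst.aestronglyMeasurable C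
      (.of_forall fun p => hC _))]
  refine VectorMeasure.tendsto_integral_of_dominated_convergence (fun _ => C) (fun k => ?_)
    (integrable_const C) (fun k => .of_forall fun p => ?_) (.of_forall fun p => ?_)
  · exact (hψfst.mul ((hη.continuous k).comp continuous_snd)).aestronglyMeasurable
  · rw [norm_mul]
    exact (mul_le_of_le_one_right (norm_nonneg _) (hη.norm_le_one k _)).trans (hC _)
  · simpa using (hη.tendsto_one p.2).const_mul (ψ p.1)

end IsCutoffSequence

end Cutoff

section Projection

lemma map_fst_eq_zero_of_disjoint {α β : Type*} [MeasurableSpace α] [MeasurableSpace β]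
    {μ : SignedMeasure (α × β)} {Ω : Set α}
    (h : ∀ A, MeasurableSet A → Disjoint A (Ω ×ˢ univ) → μ A = 0) {A : Set α}
    (hA : MeasurableSet A) (hd : Disjoint A Ω) : μ.map Prod.fst A = 0 := by
  rw [VectorMeasure.map_apply _ measurable_fst hA]
  exact h _ (measurable_fst hA) (disjoint_left.2 fun p hp hp' => disjoint_left.1 hd hp hp'.1)

lemma map_totalVar_eq {α β ι : Type*} [MeasurableSpace α] [MeasurableSpace β] [Fintype ι]
    {g : α → β} (hg : Measurable g) {μ : ι → SignedMeasure α}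
    (h : totalVar μ univ ≤ totalVar (fun i => (μ i).map g) univ) :
    (totalVar μ).map g = totalVar fun i => (μ i).map g := by
  refine (Measure.eq_of_le_of_measure_univ_eq (totalVar_map_le hg μ) (le_antisymm ?_ ?_)).symm
  · exact totalVar_map_le hg μ univ
  · rwa [Measure.map_apply hg .univ, preimage_univ]

-- As `d` has mean zero, the slices may be cut off at `t = 0` without changing the integral.
lemma integral_setIntegral_Iio_mul {α : Type*} [MeasureSpace α] [SFinite (volume : Measure α)]
    {v d : α → ℝ} (hv : Measurable v) {θ : ℝ → ℝ} (hθ : Integrable θ) (hd : Integrable d)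
    (hd0 : ∫ x, d x = 0) :
    ∫ x, ∫ t in Iio (v x), d x * θ t = ∫ x, (∫ t in 0..v x, θ t) * d x := by
  calc ∫ x, ∫ t in Iio (v x), d x * θ t
      = (∫ x, ∫ t in Iio (v x), d x * θ t) - ∫ x, d x * ∫ t in Iio 0, θ t := by
        rw [integral_mul_const, hd0, zero_mul, sub_zero]
    _ = ∫ x, ((∫ t in Iio (v x), d x * θ t) - d x * ∫ t in Iio 0, θ t) :=
        (integral_sub (integrable_setIntegral_Iio hv (hd.mul_prod hθ)) (hd.mul_const _)).symm
    _ = ∫ x, (∫ t in 0..v x, θ t) * d x := by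
        congr 1 with x
        rw [integral_const_mul, ← mul_sub, mul_comm,
          intervalIntegral.integral_Iio_sub_Iio' hθ.integrableOn hθ.integrableOn]

variable {E : Type*} [NormedAddCommGroup E] [NormedSpace ℝ E] [FiniteDimensional ℝ E]
  [MeasureSpace E] [BorelSpace E] [(volume : Measure E).IsAddHaarMeasure]
  {Ω : Set E} {v : E → ℝ} {μ : SignedMeasure (E × ℝ)}

lemma setIntegral_undergraph_divergence_mul_comp_snd (hv : Measurable v) {X : E → E}
    (hX : ContDiff ℝ 1 X) {ψ : E → ℝ} (hψ : ContDiff ℝ 1 ψ) (hψc : HasCompactSupport ψ)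
    {θ : ℝ → ℝ} (hθ : ContDiff ℝ 1 θ) (hθc : HasCompactSupport θ) :
    ∫ p in undergraph v, divergence (fun q => (ψ q.1 * θ q.2) • horizontalLift X q) p =
      ∫ x, (∫ t in 0..v x, θ t) * divergence (fun y => ψ y • X y) x := by
  have hφ : ContDiff ℝ 1 fun p : E × ℝ => ψ p.1 * θ p.2 := by fun_prop
  have hV : ContDiff ℝ 1 fun y => ψ y • X y := hψ.smul hX
  have hdiv x t : divergence (fun q => (ψ q.1 * θ q.2) • horizontalLift X q) (x, t) =
      divergence (fun y => ψ y • X y) x * θ t := by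
    rw [divergence_smul_horizontalLift_eq_slice (hφ.differentiable one_ne_zero _)
      (hX.differentiable one_ne_zero _)]
    simp only [mul_comm (ψ _), mul_smul]
    rw [divergence_smul (differentiableAt_const _) (hV.differentiable one_ne_zero _)]
    simp [mul_comm]
  rw [setIntegral_undergraph hv (integrable_divergence_smul volume hφ
    (hasCompactSupport_mul_comp_snd hψc hθc) (contDiff_horizontalLift hX))]
  simp_rw [hdiv]
  exact integral_setIntegral_Iio_mul hv (hθ.continuous.integrable_of_hasCompactSupport hθc)
    (integrable_divergence_smul volume hψ hψc hX)
    (integral_divergence_eq_zero volume hV hψc.smul_right)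

lemma HasWeakDeriv.map_fst_of_horizontalLift {X : E → E} (hX : ContDiff ℝ 1 X)
    (hvm : Measurable v) (hv : Integrable v)
    (h : HasWeakDeriv (horizontalLift X) (Ω ×ˢ univ) ((undergraph v).indicator fun _ => 1) μ) :
    HasWeakDeriv X Ω v (μ.map Prod.fst) := by
  intro ψ hψ hψc hψt
  obtain ⟨η, hη⟩ := exists_isCutoffSequence
  have hd := continuous_divergence_smul hψ hX
  obtain ⟨C, hC⟩ := hd.bounded_above_of_compact_support (hasCompactSupport_divergence_smul hψc X)
  have hΩ : ∫ x in Ω, v x * divergence (fun y => ψ y • X y) x =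
      ∫ x, v x * divergence (fun y => ψ y • X y) x :=
    setIntegral_eq_integral_of_forall_compl_eq_zero fun x hx => by
      rw [image_eq_zero_of_notMem_tsupport fun h =>
        hx (hψt (tsupport_divergence_smul_subset ψ X h)), mul_zero]
  rw [hΩ]
  refine tendsto_nhds_unique (hη.tendsto_integral_mul_comp_snd μ hψ.continuous hψc)
    ((hη.tendsto_integral_intervalIntegral_mul hvm hv hd.aestronglyMeasurable hC).neg.congr
      fun k => ?_)
  have hηk : ContDiff ℝ 1 (η k) := (hη.contDiff k).of_le (by simp)
  rw [(hasWeakDeriv_indicator_one_iff (measurableSet_undergraph hvm)).1 h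
      (fun p => ψ p.1 * η k p.2) (by fun_prop)
      (hasCompactSupport_mul_comp_snd hψc (hη.hasCompactSupport k))
      (tsupport_mul_comp_snd_subset hψt _),
    setIntegral_undergraph_divergence_mul_comp_snd hvm hX hψ hψc hηk (hη.hasCompactSupport k)]

lemma HasWeakDeriv.integral_map_fst_of_vertical (hv : Measurable v)
    (h : HasWeakDeriv (fun _ => (0, 1)) (Ω ×ˢ univ) ((undergraph v).indicator fun _ => 1) μ)
    {ψ : E → ℝ} (hψ : ContDiff ℝ 1 ψ) (hψc : HasCompactSupport ψ) (hψt : tsupport ψ ⊆ Ω) :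
    ∫ᵛ x, ψ x ∂•(μ.map Prod.fst) = -∫ x, ψ x := by
  obtain ⟨η, hη⟩ := exists_isCutoffSequence
  refine tendsto_nhds_unique (hη.tendsto_integral_mul_comp_snd μ hψ.continuous hψc)
    ((hη.tendsto_integral_mul_comp hv
      (hψ.continuous.integrable_of_hasCompactSupport hψc)).neg.congr fun k => ?_)
  have hηk : ContDiff ℝ 1 (η k) := (hη.contDiff k).of_le (by simp)
  have hφ : ContDiff ℝ 1 fun p : E × ℝ => ψ p.1 * η k p.2 := by fun_prop
  have hφc := hasCompactSupport_mul_comp_snd hψc (hη.hasCompactSupport k)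
  rw [(hasWeakDeriv_indicator_one_iff (measurableSet_undergraph hv)).1 h _ hφ hφc
      (tsupport_mul_comp_snd_subset hψt _),
    setIntegral_undergraph_divergence_vertical hv hφ hφc]

end Projection

lemma exists_measurable_integrable_ae_eq {α : Type*} [MeasurableSpace α] {μ : Measure α}
    {Ω : Set α} (hΩ : MeasurableSet Ω) {u : α → ℝ} (hu : IntegrableOn u Ω μ) :
    ∃ v : α → ℝ, Measurable v ∧ Integrable v μ ∧ (∀ x ∉ Ω, v x = 0) ∧ u =ᵐ[μ.restrict Ω] v := by
  obtain ⟨w, hw, huw⟩ := hu.aestronglyMeasurable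
  exact ⟨Ω.indicator w, hw.measurable.indicator hΩ,
    (integrable_indicator_iff hΩ).2 (hu.congr huw), fun x hx => indicator_of_notMem hx _,
    huw.trans (indicator_ae_eq_restrict hΩ).symm⟩

lemma exists_contDiff_hasCompactSupport_eqOn {E : Type*} [NormedAddCommGroup E] [NormedSpace ℝ E]
    [FiniteDimensional ℝ E] {X : E → E} (hX : ContDiff ℝ 1 X) {Ω : Set E}
    (hΩ : Bornology.IsBounded Ω) :
    ∃ Y : E → E, ContDiff ℝ 1 Y ∧ HasCompactSupport Y ∧ EqOn X Y Ω := by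
  have := FiniteDimensional.proper_real E
  obtain ⟨χ, hχ, hχc, -, -, hχ1⟩ := exists_contDiff_eq_one_on_isCompact hΩ.isCompact_closure
    isOpen_univ (subset_univ _)
  refine ⟨fun x => χ x • X x, (hχ.of_le (by simp)).smul hX, hχc.smul_right, fun x hx => ?_⟩
  simp [hχ1 (subset_closure hx)]

section LebesgueSigned

variable {n : ℕ} {Ω : Set (EuclideanSpace ℝ (Fin n))} (hΩb : Bornology.IsBounded Ω)
include hΩb

lemma isFiniteMeasure_restrict : IsFiniteMeasure (volume.restrict Ω) :=
  ⟨by simpa using hΩb.measure_lt_top⟩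

lemma lebesgueSigned_eq_zero_of_disjoint {A : Set (EuclideanSpace ℝ (Fin n))}
    (hA : MeasurableSet A) (hd : Disjoint A Ω) : lebesgueSigned Ω hΩb A = 0 := by
  have := isFiniteMeasure_restrict hΩb
  rw [lebesgueSigned, Measure.toSignedMeasure_apply_measurable hA, measureReal_restrict_apply hA,
    hd.inter_eq, measureReal_empty]

lemma integral_neg_lebesgueSigned {ψ : EuclideanSpace ℝ (Fin n) → ℝ} (hψ : tsupport ψ ⊆ Ω) :
    ∫ᵛ x, ψ x ∂•(-lebesgueSigned Ω hΩb) = -∫ x, ψ x := by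
  have := isFiniteMeasure_restrict hΩb
  rw [VectorMeasure.integral_neg_vectorMeasure, lebesgueSigned, integral_signed_toSignedMeasure,
    setIntegral_eq_integral_of_forall_compl_eq_zero fun x hx =>
      image_eq_zero_of_notMem_tsupport fun h => hx (hψ h)]

lemma variation_neg_lebesgueSigned :
    (-lebesgueSigned Ω hΩb).variation = volume.restrict Ω := by
  have := isFiniteMeasure_restrict hΩb
  rw [VectorMeasure.variation_neg, lebesgueSigned, Measure.variation_toSignedMeasure]

end LebesgueSigned

section Subgraph

variable {n m : ℕ} {X : Fin m → EuclideanSpace ℝ (Fin n) → EuclideanSpace ℝ (Fin n)}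
  {Ω : Set (EuclideanSpace ℝ (Fin n))} {u v : EuclideanSpace ℝ (Fin n) → ℝ}
  {Du : Fin m → SignedMeasure (EuclideanSpace ℝ (Fin n))}
  {Dχ : Fin (m + 1) → SignedMeasure (EuclideanSpace ℝ (Fin n) × ℝ)}

lemma extend_castSucc (i : Fin m) : extend X i.castSucc = horizontalLift (X i) :=
  Fin.snoc_castSucc ..

lemma extend_last : extend X (Fin.last m) = fun _ => (0, 1) :=
  Fin.snoc_last ..

@[simp]
lemma appendNegLebesgue_castSucc (hΩb : Bornology.IsBounded Ω) (i : Fin m) :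
    appendNegLebesgue Ω hΩb Du i.castSucc = Du i :=
  Fin.snoc_castSucc ..

@[simp]
lemma appendNegLebesgue_last (hΩb : Bornology.IsBounded Ω) :
    appendNegLebesgue Ω hΩb Du (Fin.last m) = -lebesgueSigned Ω hΩb :=
  Fin.snoc_last ..

lemma contDiff_extend (hX : ∀ i, ContDiff ℝ 1 (X i)) (j : Fin (m + 1)) :
    ContDiff ℝ 1 (extend X j) := by
  cases j using Fin.lastCases with
  | last =>
    rw [extend_last]
    exact contDiff_const
  | cast i =>
    rw [extend_castSucc]
    exact contDiff_horizontalLift (hX i)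

lemma indicator_subgraph_ae_eq (hΩ : MeasurableSet Ω) (huv : u =ᵐ[volume.restrict Ω] v) :
    (subgraph Ω u).indicator (fun _ => (1 : ℝ)) =ᵐ[volume.restrict (Ω ×ˢ univ)]
      (undergraph v).indicator fun _ => 1 := by
  rw [Measure.volume_eq_prod, ← Measure.prod_restrict, Measure.restrict_univ]
  filter_upwards [Measure.quasiMeasurePreserving_fst.ae huv,
    Measure.quasiMeasurePreserving_fst.ae (ae_restrict_mem hΩ)] with p hp hpΩ
  have h : p ∈ subgraph Ω u ↔ p ∈ undergraph v := by
    simp [subgraph, undergraph, hpΩ, hp]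
  by_cases hpu : p ∈ subgraph Ω u
  · rw [indicator_of_mem hpu, indicator_of_mem (h.1 hpu)]
  · rw [indicator_of_notMem hpu, indicator_of_notMem (h.not.1 hpu)]

lemma locallyIntegrableOn_indicator_subgraph (hΩ : MeasurableSet Ω) (hv : Measurable v)
    (huv : u =ᵐ[volume.restrict Ω] v) :
    LocallyIntegrableOn ((subgraph Ω u).indicator fun _ => (1 : ℝ)) (Ω ×ˢ univ) :=
  (((locallyIntegrable_const 1).indicator (measurableSet_undergraph hv)).locallyIntegrableOn
    _).congr (indicator_subgraph_ae_eq hΩ huv).symm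

lemma isHDeriv_extend_subgraph_iff (hX : ∀ i, ContDiff ℝ 1 (X i)) (hΩ : IsOpen Ω)
    (hv : Measurable v) (huv : u =ᵐ[volume.restrict Ω] v) :
    IsHDeriv (extend X) (Ω ×ˢ univ) ((subgraph Ω u).indicator fun _ => (1 : ℝ)) Dχ ↔
      (∀ j A, MeasurableSet A → Disjoint A (Ω ×ˢ univ) → Dχ j A = 0) ∧
      ∀ j, HasWeakDeriv (extend X j) (Ω ×ˢ univ) ((undergraph v).indicator fun _ => 1)
        (Dχ j) := by
  rw [isHDeriv_iff (contDiff_extend hX) (hΩ.prod isOpen_univ)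
    (locallyIntegrableOn_indicator_subgraph hΩ.measurableSet hv huv)]
  simp only [hasWeakDeriv_congr_ae (indicator_subgraph_ae_eq hΩ.measurableSet huv)]

lemma tendstoUndergraphDeriv_extend (hX : ∀ i, ContDiff ℝ 1 (X i)) (hΩ : IsOpen Ω)
    (hΩb : Bornology.IsBounded Ω) {ρ : ℕ → EuclideanSpace ℝ (Fin n) → ℝ}
    (hρ : IsMollifierSequence ρ) (hvm : Measurable v) (hv : Integrable v)
    (hv0 : ∀ x ∉ Ω, v x = 0) (hDu : ∀ i, HasWeakDeriv (X i) Ω v (Du i)) (j : Fin (m + 1)) :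
    TendstoUndergraphDeriv ρ v Ω (appendNegLebesgue Ω hΩb Du j) (extend X j) := by
  cases j using Fin.lastCases with
  | last =>
    have := isFiniteMeasure_restrict hΩb
    rw [extend_last, appendNegLebesgue_last]
    exact hρ.tendstoUndergraphDeriv_vertical hvm hv hΩ
  | cast i =>
    obtain ⟨Y, hY, hYc, hXY⟩ := exists_contDiff_hasCompactSupport_eqOn (hX i) hΩb
    have hYX : EqOn (horizontalLift Y) (horizontalLift (X i)) (Ω ×ˢ univ) := fun p hp => by
      rw [horizontalLift, horizontalLift, hXY hp.1]
    rw [extend_castSucc, appendNegLebesgue_castSucc]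
    exact (hρ.tendstoUndergraphDeriv_horizontalLift hvm hv hΩ hv0 hY hYc
      ((hDu i).congr_field hXY)).congr_field hYX

lemma memBVH_iff_hasFiniteHPerimeter (hX : ∀ i, ContDiff ℝ 1 (X i)) (hΩ : IsOpen Ω)
    (hΩb : Bornology.IsBounded Ω) (hu : IntegrableOn u Ω) :
    MemBVH X Ω u ↔ HasFiniteHPerimeter (extend X) (Ω ×ˢ univ) (subgraph Ω u) := by
  obtain ⟨v, hvm, hv, hv0, huv⟩ := exists_measurable_integrable_ae_eq hΩ.measurableSet hu
  have hsub : subgraph Ω u ⊆ Ω ×ˢ univ := fun p hp => ⟨hp.1, mem_univ _⟩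
  have hloc := locallyIntegrableOn_indicator_subgraph hΩ.measurableSet hvm huv
  simp only [MemBVH, HasFiniteHPerimeter, hu, hsub, hloc, true_and,
    isHDeriv_extend_subgraph_iff hX hΩ hvm huv, isHDeriv_iff hX hΩ hu.locallyIntegrableOn,
    hasWeakDeriv_congr_ae huv]
  constructor
  · rintro ⟨Du, -, hDu⟩
    obtain ⟨ρ, hρ⟩ := exists_isMollifierSequence (E := EuclideanSpace ℝ (Fin n))
    choose Dχ hχ0 hχ using fun j =>
      (tendstoUndergraphDeriv_extend hX hΩ hΩb hρ hvm hv hv0 hDu j).exists_hasWeakDeriv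
        hρ.isMollifier hvm hv hΩ.measurableSet
    exact ⟨Dχ, hχ0, hχ⟩
  · rintro ⟨Dχ, hχ0, hχ⟩
    refine ⟨fun i => (Dχ i.castSucc).map Prod.fst,
      fun i _ hA hd => map_fst_eq_zero_of_disjoint (hχ0 i.castSucc) hA hd, fun i => ?_⟩
    exact HasWeakDeriv.map_fst_of_horizontalLift (hX i) hvm hv
      (extend_castSucc (X := X) i ▸ hχ i.castSucc)

lemma map_fst_eq_appendNegLebesgue (hX : ∀ i, ContDiff ℝ 1 (X i)) (hΩ : IsOpen Ω)
    (hΩb : Bornology.IsBounded Ω) (hu : IntegrableOn u Ω) (hDu : IsHDeriv X Ω u Du)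
    (hDχ : IsHDeriv (extend X) (Ω ×ˢ univ) ((subgraph Ω u).indicator fun _ => (1 : ℝ)) Dχ)
    (j : Fin (m + 1)) : (Dχ j).map Prod.fst = appendNegLebesgue Ω hΩb Du j := by
  obtain ⟨v, hvm, hv, -, huv⟩ := exists_measurable_integrable_ae_eq hΩ.measurableSet hu
  obtain ⟨hχ0, hχ⟩ := (isHDeriv_extend_subgraph_iff hX hΩ hvm huv).1 hDχ
  have hmap0 A (hA : MeasurableSet A) (hd : Disjoint A Ω) : (Dχ j).map Prod.fst A = 0 :=
    map_fst_eq_zero_of_disjoint (hχ0 j) hA hd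
  cases j using Fin.lastCases with
  | last =>
    rw [appendNegLebesgue_last]
    refine signedMeasure_eq_of_forall_integral_eq hΩ hmap0 (fun A hA hd => ?_)
      fun ψ hψ hc ht => ?_
    · simp [lebesgueSigned_eq_zero_of_disjoint hΩb hA hd]
    · rw [integral_neg_lebesgueSigned hΩb ht]
      exact HasWeakDeriv.integral_map_fst_of_vertical hvm
        (extend_last (X := X) ▸ hχ (Fin.last m)) hψ hc ht
  | cast i =>
    rw [appendNegLebesgue_castSucc]
    refine signedMeasure_eq_of_forall_integral_eq hΩ hmap0 (hDu.concentrated i)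
      fun ψ hψ hc ht => ?_
    have hmap : HasWeakDeriv (X i) Ω v ((Dχ i.castSucc).map Prod.fst) :=
      HasWeakDeriv.map_fst_of_horizontalLift (hX i) hvm hv
        (extend_castSucc (X := X) i ▸ hχ i.castSucc)
    rw [hDu.hasWeakDeriv i ψ hψ hc ht, (hasWeakDeriv_congr_ae huv).2 hmap ψ hψ hc ht]

lemma map_fst_totalVar_eq (hX : ∀ i, ContDiff ℝ 1 (X i)) (hΩ : IsOpen Ω)
    (hΩb : Bornology.IsBounded Ω) (hu : IntegrableOn u Ω) (hDu : IsHDeriv X Ω u Du)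
    (hDχ : IsHDeriv (extend X) (Ω ×ˢ univ) ((subgraph Ω u).indicator fun _ => (1 : ℝ)) Dχ)
    {κ : Type*} [Fintype κ] (e : κ → Fin (m + 1)) :
    (totalVar fun i => Dχ (e i)).map Prod.fst =
      totalVar fun i => appendNegLebesgue Ω hΩb Du (e i) := by
  obtain ⟨v, hvm, hv, hv0, huv⟩ := exists_measurable_integrable_ae_eq hΩ.measurableSet hu
  obtain ⟨ρ, hρ⟩ := exists_isMollifierSequence (E := EuclideanSpace ℝ (Fin n))
  obtain ⟨hχ0, hχ⟩ := (isHDeriv_extend_subgraph_iff hX hΩ hvm huv).1 hDχ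
  have hmap := map_fst_eq_appendNegLebesgue hX hΩ hΩb hu hDu hDχ
  have htends := tendstoUndergraphDeriv_extend hX hΩ hΩb hρ hvm hv hv0 fun i =>
    (hasWeakDeriv_congr_ae huv).1 (hDu.hasWeakDeriv i)
  have hle : totalVar (fun i => Dχ (e i)) univ ≤
      totalVar (fun i => appendNegLebesgue Ω hΩb Du (e i)) univ :=
    TendstoUndergraphDeriv.totalVar_univ_le (fun i => htends (e i)) hρ.isMollifier hvm hv hΩ
      (fun i => hχ0 (e i)) fun i => hχ (e i)
  simp_rw [← hmap] at hle ⊢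
  exact map_totalVar_eq measurable_fst hle

lemma map_fst_variation_eq (hX : ∀ i, ContDiff ℝ 1 (X i)) (hΩ : IsOpen Ω)
    (hΩb : Bornology.IsBounded Ω) (hu : IntegrableOn u Ω) (hDu : IsHDeriv X Ω u Du)
    (hDχ : IsHDeriv (extend X) (Ω ×ˢ univ) ((subgraph Ω u).indicator fun _ => (1 : ℝ)) Dχ)
    (j : Fin (m + 1)) :
    (Dχ j).variation.map Prod.fst = (appendNegLebesgue Ω hΩb Du j).variation := by
  simpa only [totalVar_unique] using
    map_fst_totalVar_eq hX hΩ hΩb hu hDu hDχ fun _ : Unit => j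

end Subgraph

end HVar

end

theorem theorem4_general {n m : ℕ}
    (X : Fin m → EuclideanSpace ℝ (Fin n) → EuclideanSpace ℝ (Fin n))
    (hX : ∀ i, ContDiff ℝ 1 (X i))
    (Ω : Set (EuclideanSpace ℝ (Fin n))) (hΩ : IsOpen Ω) (hΩb : Bornology.IsBounded Ω)
    (u : EuclideanSpace ℝ (Fin n) → ℝ) (hu : IntegrableOn u Ω) :
    (HVar.MemBVH X Ω u ↔
      HVar.HasFiniteHPerimeter (HVar.extend X) (Ω ×ˢ univ) (HVar.subgraph Ω u)) ∧
    ∀ (Du : Fin m → SignedMeasure (EuclideanSpace ℝ (Fin n)))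
      (Dχ : Fin (m + 1) → SignedMeasure (EuclideanSpace ℝ (Fin n) × ℝ)),
      HVar.IsHDeriv X Ω u Du →
      HVar.IsHDeriv (HVar.extend X) (Ω ×ˢ univ)
        ((HVar.subgraph Ω u).indicator fun _ => (1 : ℝ)) Dχ →
      (∀ i : Fin m, (Dχ i.castSucc).map Prod.fst = Du i) ∧
      (Dχ (Fin.last m)).map Prod.fst = -HVar.lebesgueSigned Ω hΩb ∧
      (∀ i : Fin m,
        (Dχ i.castSucc).variation.map Prod.fst = (Du i).variation) ∧
      (Dχ (Fin.last m)).variation.map Prod.fst = volume.restrict Ω ∧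
      (HVar.totalVar fun i : Fin m => Dχ i.castSucc).map Prod.fst = HVar.totalVar Du ∧
      (HVar.totalVar Dχ).map Prod.fst =
        HVar.totalVar (HVar.appendNegLebesgue Ω hΩb Du) := by
  refine ⟨HVar.memBVH_iff_hasFiniteHPerimeter hX hΩ hΩb hu, fun Du Dχ hDu hDχ => ?_⟩
  have hmap := HVar.map_fst_eq_appendNegLebesgue hX hΩ hΩb hu hDu hDχ
  have hvar := HVar.map_fst_variation_eq hX hΩ hΩb hu hDu hDχ
  refine ⟨fun i => ?_, ?_, fun i => ?_, ?_, ?_, ?_⟩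
  · rw [hmap, HVar.appendNegLebesgue_castSucc]
  · rw [hmap, HVar.appendNegLebesgue_last]
  · rw [hvar, HVar.appendNegLebesgue_castSucc]
  · rw [hvar, HVar.appendNegLebesgue_last, HVar.variation_neg_lebesgueSigned]
  · simpa only [HVar.appendNegLebesgue_castSucc] using
      HVar.map_fst_totalVar_eq hX hΩ hΩb hu hDu hDχ Fin.castSucc
  · exact HVar.map_fst_totalVar_eq hX hΩ hΩb hu hDu hDχ id

theorem theorem4 {n m : ℕ}
    (X : Fin m → EuclideanSpace ℝ (Fin n) → EuclideanSpace ℝ (Fin n))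
    (hX : ∀ i, ContDiff ℝ ∞ (X i)) (hXli : LinearIndependent ℝ X)
    (Ω : Set (EuclideanSpace ℝ (Fin n))) (hΩ : IsOpen Ω) (hΩb : Bornology.IsBounded Ω)
    (u : EuclideanSpace ℝ (Fin n) → ℝ) (hu : IntegrableOn u Ω) :
    (HVar.MemBVH X Ω u ↔
      HVar.HasFiniteHPerimeter (HVar.extend X) (Ω ×ˢ univ) (HVar.subgraph Ω u)) ∧
    ∀ (Du : Fin m → SignedMeasure (EuclideanSpace ℝ (Fin n)))
      (Dχ : Fin (m + 1) → SignedMeasure (EuclideanSpace ℝ (Fin n) × ℝ)),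
      HVar.IsHDeriv X Ω u Du →
      HVar.IsHDeriv (HVar.extend X) (Ω ×ˢ univ)
        ((HVar.subgraph Ω u).indicator fun _ => (1 : ℝ)) Dχ →
      (∀ i : Fin m, (Dχ i.castSucc).map Prod.fst = Du i) ∧
      (Dχ (Fin.last m)).map Prod.fst = -HVar.lebesgueSigned Ω hΩb ∧
      (∀ i : Fin m,
        (Dχ i.castSucc).variation.map Prod.fst = (Du i).variation) ∧
      (Dχ (Fin.last m)).variation.map Prod.fst = volume.restrict Ω ∧
      (HVar.totalVar fun i : Fin m => Dχ i.castSucc).map Prod.fst = HVar.totalVar Du ∧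
      (HVar.totalVar Dχ).map Prod.fst =
        HVar.totalVar (HVar.appendNegLebesgue Ω hΩb Du) :=
  theorem4_general X (fun i => (hX i).of_le (by simp)) Ω hΩ hΩb u hu
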